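/- Let $\mu$ be normalized Haar measure (arc length) on the unit circle $\mathbb{T}$, let $1\le p<\infty$, and let $\lambda$ be a probability measure on $\mathbb{T}$ that is mutually absolutely continuous with $\mu$. Put $g=d\lambda/d\mu$ and assume $\int_{\mathbb{T}}|\log g|\,d\mu=\infty$. Let $H^p(\mu)$ be the closure in $L^p(\mu)$ of the polynomials in the coordinate function $z$, and let $M_0=g^{-1/p}H^p(\mu)=\{g^{-1/p}f : f\in H^p(\mu)\}\subseteq L^p(\lambda)$. Then a linear subspace $M$ of $L^p(\lambda)$ is closed and satisfies $zM\subseteq M$ if and only if (1) $M=\varphi M_0$ for some measurable function $\varphi$ on $\mathbb{T}$ with $|\varphi|=1$ almost everywhere, or (2) $M=\chi_E L^p(\lambda)$ for some Borel set $E\subseteq\mathbb{T}$. -/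

import Mathlib

open MeasureTheory
open scoped ENNReal

noncomputable section

namespace BeurlingCircle

instance : MeasurableSpace Circle := borel Circle

instance : BorelSpace Circle := ⟨rfl⟩

/-- Normalized Haar measure (normalized arc length) on the unit circle. -/
def haarCircle : Measure Circle := Measure.haarMeasure ⊤

instance : IsProbabilityMeasure haarCircle :=
  ⟨by simpa [haarCircle] using
    Measure.haarMeasure_self (K₀ := (⊤ : TopologicalSpace.PositiveCompacts Circle))⟩

/-- `mulSubspace w hac S` is the subspace `w • S = {w h : h ∈ S}` of `L^p(lam)`, for a function `w`
on the circle and a subspace `S` of `L^p(ν)`; the products are taken almost everywhere, which is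
meaningful because `lam ≪ ν`. (In all uses below, every product `w h` does lie in `L^p(lam)`.) -/
def mulSubspace {p : ℝ≥0∞} {lam ν : Measure Circle} (w : Circle → ℂ) (hac : lam ≪ ν)
    (S : Submodule ℂ (Lp ℂ p ν)) : Submodule ℂ (Lp ℂ p lam) where
  carrier := {f | ∃ h ∈ S, f =ᵐ[lam] fun x => w x * h x}
  zero_mem' := by
    refine ⟨0, S.zero_mem, ?_⟩
    filter_upwards [Lp.coeFn_zero ℂ p lam, hac.ae_le (Lp.coeFn_zero ℂ p ν)] with x h1 h2
    rw [h1, h2]; simp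
  add_mem' := by
    rintro f₁ f₂ ⟨h₁, hS₁, e₁⟩ ⟨h₂, hS₂, e₂⟩
    refine ⟨h₁ + h₂, S.add_mem hS₁ hS₂, ?_⟩
    filter_upwards [e₁, e₂, Lp.coeFn_add f₁ f₂, hac.ae_le (Lp.coeFn_add h₁ h₂)] with x a b c d
    rw [c, d, Pi.add_apply, Pi.add_apply, a, b, mul_add]
  smul_mem' := by
    rintro k f ⟨h, hS, e⟩
    refine ⟨k • h, S.smul_mem k hS, ?_⟩
    filter_upwards [e, Lp.coeFn_smul k f, hac.ae_le (Lp.coeFn_smul k h)] with x a b c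
    rw [b, c, Pi.smul_apply, Pi.smul_apply, a, smul_eq_mul, smul_eq_mul, mul_left_comm]

/-- The coordinate function `z` on the circle. -/
def coordinate : C(Circle, ℂ) := ⟨fun z => (z : ℂ), by fun_prop⟩

/-- `H^p(ν)`: the closure in `L^p(ν)` of the polynomials in `z`. -/
def hardySpace (p : ℝ≥0∞) [Fact (1 ≤ p)] (ν : Measure Circle) [IsFiniteMeasure ν] :
    Submodule ℂ (Lp ℂ p ν) :=
  (Submodule.span ℂ
    (Set.range fun n : ℕ => ContinuousMap.toLp p ν ℂ (coordinate ^ n))).topologicalClosure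

/-- The density `g = d lam / dμ` with respect to normalized Haar measure. -/
def density (lam : Measure Circle) (x : Circle) : ℝ := (lam.rnDeriv haarCircle x).toReal

/-- The subspace `M₀ = g^{-1/p} H^p(μ)` of `L^p(lam)`, where `g = d lam / dμ`. -/
def weightedHardy (p : ℝ≥0∞) [Fact (1 ≤ p)] (lam : Measure Circle) (hac : lam ≪ haarCircle) :
    Submodule ℂ (Lp ℂ p lam) :=
  mulSubspace (fun x => ((density lam x ^ (-(1 / p.toReal)) : ℝ) : ℂ)) hac
    (hardySpace p haarCircle)

/-- A measurable function on the circle that has modulus one almost everywhere. -/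
def IsUnimodular (φ : Circle → ℂ) : Prop :=
  Measurable φ ∧ ∀ᵐ x ∂haarCircle, ‖φ x‖ = 1

end BeurlingCircle

end

/-!
Multiplication by `g^{-1/p}` is an isometry of `L^p(μ)` onto `L^p(λ)` that commutes with
multiplication by functions, so everything reduces to the Beurling–Helson theorem for Haar
measure.

For `p ≥ 2`, Clarkson's inequality provides nearest points in closed subspaces, and the error `F`
of a best approximation from `M` satisfies `∫ |F|^{p-2} F̄ w = 0` for all `w ∈ M`. If `z⁻¹M ⊆ M`,
uniqueness of Fourier coefficients turns this into `F w = 0`, which forces `M = χ_E L^p`. Otherwise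
let `F` be the error of approximating some `f ∈ M ∖ zM` from `zM`. Since `zⁿF ∈ zM` for `n ≥ 1`, all
nonzero Fourier coefficients of `|F|^p` vanish, so `|F|` is constant; for `φ = F / |F|`, the
orthogonality relations say exactly that the negative Fourier coefficients of `φ̄ w` vanish
for `w ∈ M`, whence `M = φ H^p`.

For `p ≤ 2`, the case of exponent two yields outer functions of prescribed modulus. Dividing
`k ∈ L^p` by a suitable outer function gives an `L²` function that generates the same closed
invariant subspace, so `M` is determined by `M ∩ L²`.
-/

noncomputable section

namespace BeurlingCircle

open Filter Topology
open scoped ComplexConjugate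

section Clarkson

lemma norm_add_rpow_add_norm_sub_rpow_le {E : Type*} [NormedAddCommGroup E]
    [InnerProductSpace ℝ E] {r : ℝ} (hr : 2 ≤ r) (a b : E) :
    ‖a + b‖ ^ r + ‖a - b‖ ^ r ≤ 2 ^ (r - 1) * (‖a‖ ^ r + ‖b‖ ^ r) := by
  have hs : 1 ≤ r / 2 := by linarith
  have rpow_eq (x : E) : ‖x‖ ^ r = (‖x‖ ^ 2) ^ (r / 2) := by
    rw [← Real.rpow_natCast, ← Real.rpow_mul (norm_nonneg x), Nat.cast_ofNat,
      mul_div_cancel₀ _ two_ne_zero]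
  have parallelogram : ‖a + b‖ ^ 2 + ‖a - b‖ ^ 2 = 2 * (‖a‖ ^ 2 + ‖b‖ ^ 2) := by
    linear_combination parallelogram_law_with_norm ℝ a b
  have power_mean : (‖a‖ ^ 2 + ‖b‖ ^ 2) ^ (r / 2) ≤
      2 ^ (r / 2 - 1) * ((‖a‖ ^ 2) ^ (r / 2) + (‖b‖ ^ 2) ^ (r / 2)) := by
    exact_mod_cast NNReal.rpow_add_le_mul_rpow_add_rpow (‖a‖₊ ^ (2 : ℕ)) (‖b‖₊ ^ (2 : ℕ)) hs
  calc ‖a + b‖ ^ r + ‖a - b‖ ^ r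
      = (‖a + b‖ ^ 2) ^ (r / 2) + (‖a - b‖ ^ 2) ^ (r / 2) := by rw [rpow_eq, rpow_eq (a - b)]
    _ ≤ (‖a + b‖ ^ 2 + ‖a - b‖ ^ 2) ^ (r / 2) :=
        Real.add_rpow_le_rpow_add (by positivity) (by positivity) hs
    _ = 2 ^ (r / 2) * (‖a‖ ^ 2 + ‖b‖ ^ 2) ^ (r / 2) := by
        rw [parallelogram, Real.mul_rpow (by norm_num) (by positivity)]
    _ ≤ 2 ^ (r / 2) * (2 ^ (r / 2 - 1) * ((‖a‖ ^ 2) ^ (r / 2) + (‖b‖ ^ 2) ^ (r / 2))) := by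
        gcongr
    _ = 2 ^ (r - 1) * (‖a‖ ^ r + ‖b‖ ^ r) := by
        rw [← mul_assoc, ← Real.rpow_add two_pos, rpow_eq, rpow_eq b]
        ring_nf

variable {α E : Type*} {m : MeasurableSpace α} {ν : Measure α} [NormedAddCommGroup E] {p : ℝ≥0∞}

lemma Lp_integrable_norm_rpow (hp0 : p ≠ 0) (hp : p ≠ ⊤) (f : Lp E p ν) :
    Integrable (fun x ↦ ‖f x‖ ^ p.toReal) ν :=
  (Lp.memLp f).integrable_norm_rpow hp0 hp

lemma Lp_norm_rpow_eq_integral (hp0 : p ≠ 0) (hp : p ≠ ⊤) (f : Lp E p ν) :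
    ‖f‖ ^ p.toReal = ∫ x, ‖f x‖ ^ p.toReal ∂ν := by
  rw [Lp.norm_def, (Lp.memLp f).eLpNorm_eq_integral_rpow_norm hp0 hp,
    ENNReal.toReal_ofReal (by positivity),
    Real.rpow_inv_rpow (by positivity) (ENNReal.toReal_pos hp0 hp).ne']

lemma Lp_norm_add_rpow_add_norm_sub_rpow_le [InnerProductSpace ℝ E] (hp2 : 2 ≤ p) (hp : p ≠ ⊤)
    (f g : Lp E p ν) :
    ‖f + g‖ ^ p.toReal + ‖f - g‖ ^ p.toReal ≤
      2 ^ (p.toReal - 1) * (‖f‖ ^ p.toReal + ‖g‖ ^ p.toReal) := by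
  have hp0 : p ≠ 0 := (two_pos.trans_le hp2).ne'
  have hint := Lp_integrable_norm_rpow (E := E) (ν := ν) hp0 hp
  simp only [Lp_norm_rpow_eq_integral hp0 hp]
  rw [← integral_add (hint _) (hint _), ← integral_add (hint _) (hint _), ← integral_const_mul]
  refine integral_mono_ae ((hint _).add (hint _)) (((hint _).add (hint _)).const_mul _) ?_
  filter_upwards [Lp.coeFn_add f g, Lp.coeFn_sub f g] with x hadd hsub
  rw [hadd, hsub]
  exact norm_add_rpow_add_norm_sub_rpow_le (by simpa using ENNReal.toReal_mono hp hp2) (f x) (g x)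

end Clarkson

section NearestPoint

variable {E : Type*} [NormedAddCommGroup E] [NormedSpace ℝ E] {r : ℝ} {K : Set E}

lemma norm_sub_le_of_clarkson (hr : 0 < r)
    (clarkson : ∀ u v : E, ‖u + v‖ ^ r + ‖u - v‖ ^ r ≤ 2 ^ (r - 1) * (‖u‖ ^ r + ‖v‖ ^ r))
    (hK : Convex ℝ K) {f y z : E} (hy : y ∈ K) (hz : z ∈ K) {b : ℝ}
    (hyb : ‖f - y‖ ≤ b) (hzb : ‖f - z‖ ≤ b) :
    ‖y - z‖ ≤ (2 ^ r * (b ^ r - Metric.infDist f K ^ r)) ^ r⁻¹ := by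
  set d := Metric.infDist f K
  have hd : 0 ≤ d := Metric.infDist_nonneg
  have midpoint_far : 2 * d ≤ ‖(f - z) + (f - y)‖ := by
    have hmid := Metric.infDist_le_dist_of_mem (x := f) (hK.midpoint_mem hz hy)
    have hsum : (f - z) + (f - y) = (2 : ℝ) • (f - midpoint ℝ z y) := by
      rw [midpoint_eq_smul_add, invOf_eq_inv]; module
    rw [hsum, norm_smul, Real.norm_two, ← dist_eq_norm]
    gcongr
  have far_rpow : 2 ^ r * d ^ r ≤ ‖(f - z) + (f - y)‖ ^ r := by
    rw [← Real.mul_rpow two_pos.le hd]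
    gcongr
  have clarkson_le : ‖(f - z) + (f - y)‖ ^ r + ‖y - z‖ ^ r ≤ 2 ^ r * b ^ r := by
    calc _ = ‖(f - z) + (f - y)‖ ^ r + ‖(f - z) - (f - y)‖ ^ r := by rw [sub_sub_sub_cancel_left]
      _ ≤ 2 ^ (r - 1) * (‖f - z‖ ^ r + ‖f - y‖ ^ r) := clarkson _ _
      _ ≤ 2 ^ (r - 1) * (b ^ r + b ^ r) := by gcongr
      _ = 2 ^ r * b ^ r := by rw [Real.rpow_sub_one two_ne_zero]; ring
  calc ‖y - z‖ = (‖y - z‖ ^ r) ^ r⁻¹ := (Real.rpow_rpow_inv (norm_nonneg _) hr.ne').symm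
    _ ≤ _ := by gcongr; linarith

lemma exists_norm_sub_eq_infDist_of_clarkson [CompleteSpace E] (hr : 0 < r)
    (clarkson : ∀ u v : E, ‖u + v‖ ^ r + ‖u - v‖ ^ r ≤ 2 ^ (r - 1) * (‖u‖ ^ r + ‖v‖ ^ r))
    (hne : K.Nonempty) (hconv : Convex ℝ K) (hclosed : IsClosed K) (f : E) :
    ∃ y ∈ K, ‖f - y‖ = Metric.infDist f K := by
  set d := Metric.infDist f K with hd
  let b (n : ℕ) : ℝ := d + 1 / ((n : ℝ) + 1)
  have hb : Tendsto b atTop (𝓝 d) := by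
    simpa [b] using (tendsto_one_div_add_atTop_nhds_zero_nat (𝕜 := ℝ)).const_add d
  have exists_near (n : ℕ) : ∃ y ∈ K, ‖f - y‖ < b n := by
    simp only [← dist_eq_norm]
    exact (Metric.infDist_lt_iff hne).1 (lt_add_of_pos_right _ (by positivity))
  choose y hyK hy using exists_near
  have hcauchy : CauchySeq y := by
    refine cauchySeq_of_le_tendsto_0 (fun n ↦ (2 ^ r * (b n ^ r - d ^ r)) ^ r⁻¹)
      (fun n k N hn hk ↦ ?_) ?_
    · have hle (j : ℕ) (hj : N ≤ j) : ‖f - y j‖ ≤ b N :=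
        (hy j).le.trans (by simp only [b]; gcongr)
      rw [dist_eq_norm]
      exact norm_sub_le_of_clarkson hr clarkson hconv (hyK n) (hyK k) (hle n hn) (hle k hk)
    · have hlim := (((hb.rpow_const (p := r) (.inr hr.le)).sub_const (d ^ r)).const_mul
        (2 ^ r)).rpow_const (p := r⁻¹) (.inr (by positivity))
      simpa [Real.zero_rpow (inv_ne_zero hr.ne')] using hlim
  obtain ⟨y₀, hy₀⟩ := cauchySeq_tendsto_of_complete hcauchy
  have hy₀K : y₀ ∈ K := hclosed.mem_of_tendsto hy₀ (.of_forall hyK)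
  refine ⟨y₀, hy₀K, le_antisymm ?_ ?_⟩
  · exact le_of_tendsto_of_tendsto' (tendsto_const_nhds.sub hy₀).norm hb fun n ↦ (hy n).le
  · rw [hd, ← dist_eq_norm]
    exact Metric.infDist_le_dist_of_mem hy₀K

end NearestPoint

section FirstVariation

variable {α E : Type*} {m : MeasurableSpace α} {ν : Measure α} [NormedAddCommGroup E]
  [InnerProductSpace ℝ E] {p : ℝ≥0∞} {r : ℝ}

lemma norm_rpow_mul_inner_le (hr : 2 ≤ r) {a b : E} {c : ℝ} (ha : ‖a‖ ≤ c) (hb : ‖b‖ ≤ c) :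
    ‖‖a‖ ^ (r - 2) * inner ℝ a b‖ ≤ c ^ r := by
  have hc : 0 ≤ c := (norm_nonneg a).trans ha
  calc ‖‖a‖ ^ (r - 2) * inner ℝ a b‖ = ‖a‖ ^ (r - 2) * |inner ℝ a b| := by
        rw [norm_mul, Real.norm_of_nonneg (by positivity), Real.norm_eq_abs]
    _ ≤ c ^ (r - 2) * (c * c) := by
        gcongr
        exact (abs_real_inner_le_norm a b).trans (by gcongr)
    _ = c ^ r := by
        rw [← sq, ← Real.rpow_natCast, ← Real.rpow_add_of_nonneg hc (by linarith) (by norm_num)]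
        norm_num

lemma hasDerivAt_norm_add_smul_rpow (hr : 1 < r) (a b : E) (t : ℝ) :
    HasDerivAt (fun t : ℝ ↦ ‖a + t • b‖ ^ r)
      (r * (‖a + t • b‖ ^ (r - 2) * inner ℝ (a + t • b) b)) t := by
  have hline : HasDerivAt (fun t : ℝ ↦ a + t • b) b t := by
    simpa using ((hasDerivAt_id t).smul_const b).const_add a
  rw [← mul_assoc]
  exact (hasFDerivAt_norm_rpow (a + t • b) hr).comp_hasDerivAt t hline

lemma hasDerivAt_integral_norm_add_smul_rpow (hp2 : 2 ≤ p) (hp : p ≠ ⊤) (F w : Lp E p ν) :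
    HasDerivAt (fun t : ℝ ↦ ∫ x, ‖F x + t • w x‖ ^ p.toReal ∂ν)
      (∫ x, p.toReal * (‖F x‖ ^ (p.toReal - 2) * inner ℝ (F x) (w x)) ∂ν) 0 := by
  have hr : 2 ≤ p.toReal := by simpa using ENNReal.toReal_mono hp hp2
  have hp0 : p ≠ 0 := (two_pos.trans_le hp2).ne'
  have hF := Lp.memLp F
  have hw := Lp.memLp w
  have bound_integrable : Integrable (fun x ↦ p.toReal * (‖F x‖ + ‖w x‖) ^ p.toReal) ν := by
    refine (((hF.norm.add hw.norm).integrable_norm_rpow hp0 hp).congr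
      (.of_forall fun x ↦ ?_)).const_mul _
    simp only [Pi.add_apply]
    rw [Real.norm_of_nonneg (by positivity)]
  have bound (x : α) (t : ℝ) (ht : t ∈ Metric.ball (0 : ℝ) 1) :
      ‖p.toReal * (‖F x + t • w x‖ ^ (p.toReal - 2) * inner ℝ (F x + t • w x) (w x))‖ ≤
        p.toReal * (‖F x‖ + ‖w x‖) ^ p.toReal := by
    have ht : ‖t‖ ≤ 1 := (mem_ball_zero_iff.1 ht).le
    rw [norm_mul, Real.norm_of_nonneg ENNReal.toReal_nonneg]
    gcongr
    refine norm_rpow_mul_inner_le hr ?_ (le_add_of_nonneg_left (norm_nonneg _))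
    calc ‖F x + t • w x‖ ≤ ‖F x‖ + ‖t‖ * ‖w x‖ := (norm_add_le _ _).trans_eq (by rw [norm_smul])
      _ ≤ ‖F x‖ + ‖w x‖ := by gcongr; exact mul_le_of_le_one_left (norm_nonneg _) ht
  have deriv_meas : AEStronglyMeasurable
      (fun x ↦ p.toReal * (‖F x‖ ^ (p.toReal - 2) * inner ℝ (F x) (w x))) ν :=
    ((hF.1.norm.aemeasurable.pow_const _).aestronglyMeasurable.mul (hF.1.inner hw.1)).const_mul _
  have hderiv := (hasDerivAt_integral_of_dominated_loc_of_deriv_le (μ := ν) (x₀ := (0 : ℝ))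
    (F := fun t x ↦ ‖F x + t • w x‖ ^ p.toReal) (Metric.ball_mem_nhds _ one_pos)
    (.of_forall fun t ↦ ((hF.1.add (hw.1.const_smul t)).norm.aemeasurable.pow_const
      _).aestronglyMeasurable)
    (by simpa using hF.integrable_norm_rpow hp0 hp) (by simpa using deriv_meas)
    (.of_forall bound) bound_integrable
    (.of_forall fun x t _ ↦ hasDerivAt_norm_add_smul_rpow (by linarith) (F x) (w x) t)).2
  simpa using hderiv

lemma integral_norm_rpow_mul_inner_eq_zero (hp2 : 2 ≤ p) (hp : p ≠ ⊤) (F w : Lp E p ν)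
    (hmin : ∀ t : ℝ, ‖F‖ ≤ ‖F + t • w‖) :
    ∫ x, ‖F x‖ ^ (p.toReal - 2) * inner ℝ (F x) (w x) ∂ν = 0 := by
  have hp0 : p ≠ 0 := (two_pos.trans_le hp2).ne'
  have integral_eq (t : ℝ) : ∫ x, ‖F x + t • w x‖ ^ p.toReal ∂ν = ‖F + t • w‖ ^ p.toReal := by
    rw [Lp_norm_rpow_eq_integral hp0 hp]
    refine integral_congr_ae ?_
    filter_upwards [Lp.coeFn_add F (t • w), Lp.coeFn_smul t w] with x hadd hsmul
    rw [hadd, Pi.add_apply, hsmul, Pi.smul_apply]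
  have local_min : IsLocalMin (fun t : ℝ ↦ ∫ x, ‖F x + t • w x‖ ^ p.toReal ∂ν) 0 := by
    refine .of_forall fun t ↦ ?_
    simp only [zero_smul, add_zero, integral_eq, ← Lp_norm_rpow_eq_integral hp0 hp]
    exact Real.rpow_le_rpow ENNReal.toReal_nonneg (hmin t) ENNReal.toReal_nonneg
  have deriv_eq_zero :=
    local_min.hasDerivAt_eq_zero (hasDerivAt_integral_norm_add_smul_rpow hp2 hp F w)
  rw [integral_const_mul] at deriv_eq_zero
  exact (mul_eq_zero.1 deriv_eq_zero).resolve_left (ENNReal.toReal_pos hp0 hp).ne'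

end FirstVariation

/-- The function `|z|^(r-2) z̄`, which turns `F ∈ L^r` into its norming functional
`w ↦ ∫ |F|^(r-2) F̄ w`. -/
def normPowConj (r : ℝ) (z : ℂ) : ℂ := (‖z‖ ^ (r - 2) : ℝ) * conj z

section NormPowConj

variable {α : Type*} {m : MeasurableSpace α} {ν : Measure α} {p : ℝ≥0∞} {r : ℝ}

lemma measurable_normPowConj (r : ℝ) : Measurable (normPowConj r) := by
  unfold normPowConj
  fun_prop

lemma normPowConj_eq_zero_iff {z : ℂ} : normPowConj r z = 0 ↔ z = 0 := by
  refine ⟨fun h ↦ by_contra fun hz ↦ ?_, fun h ↦ by simp [normPowConj, h]⟩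
  have hpos : 0 < ‖z‖ ^ (r - 2) := Real.rpow_pos_of_pos (norm_pos_iff.2 hz) _
  simp [normPowConj, hz, hpos.ne'] at h

lemma normPowConj_mul_self (hr : 2 ≤ r) (z : ℂ) : normPowConj r z * z = (‖z‖ ^ r : ℝ) := by
  rw [normPowConj, mul_assoc, Complex.conj_mul', ← Complex.ofReal_pow, ← Complex.ofReal_mul,
    ← Real.rpow_natCast, ← Real.rpow_add_of_nonneg (norm_nonneg _) (by linarith) (by norm_num)]
  norm_num

lemma re_normPowConj_mul (r : ℝ) (z w : ℂ) :
    (normPowConj r z * w).re = ‖z‖ ^ (r - 2) * inner ℝ z w := by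
  rw [normPowConj, mul_assoc, Complex.re_ofReal_mul, Complex.inner, mul_comm w]

lemma norm_normPowConj (hr : 1 < r) (z : ℂ) : ‖normPowConj r z‖ = ‖z‖ ^ (r - 1) := by
  rw [normPowConj, norm_mul, RCLike.norm_conj, Complex.norm_real,
    Real.norm_of_nonneg (by positivity), ← Real.rpow_add_one' (norm_nonneg _) (by linarith)]
  ring_nf

lemma integrable_normPowConj_mul (hp1 : 1 < p) (hp : p ≠ ⊤) (F w : Lp ℂ p ν) :
    Integrable (fun x ↦ normPowConj p.toReal (F x) * w x) ν := by
  have hp0 : p ≠ 0 := (one_pos.trans hp1).ne'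
  have hr : 1 < p.toReal := by
    rwa [← ENNReal.toReal_one, ENNReal.toReal_lt_toReal ENNReal.one_ne_top hp]
  have hF := Lp.memLp F
  have hw := Lp.memLp w
  refine ((hF.norm.add hw.norm).integrable_norm_rpow hp0 hp).mono'
    (((measurable_normPowConj _).comp_aemeasurable hF.1.aemeasurable).aestronglyMeasurable.mul
      hw.1) (.of_forall fun x ↦ ?_)
  have hnonneg : 0 ≤ ‖F x‖ + ‖w x‖ := by positivity
  calc ‖normPowConj p.toReal (F x) * w x‖ = ‖F x‖ ^ (p.toReal - 1) * ‖w x‖ := by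
        rw [norm_mul, norm_normPowConj hr]
    _ ≤ (‖F x‖ + ‖w x‖) ^ (p.toReal - 1) * (‖F x‖ + ‖w x‖) := by
        gcongr <;> simp
    _ = (‖F x‖ + ‖w x‖) ^ p.toReal := by
        rw [← Real.rpow_add_one' hnonneg (by linarith), sub_add_cancel]
    _ = ‖‖F x‖ + ‖w x‖‖ ^ p.toReal := by rw [Real.norm_of_nonneg hnonneg]

theorem exists_mem_forall_integral_normPowConj_mul_eq_zero [Fact (1 ≤ p)] (hp2 : 2 ≤ p)
    (hp : p ≠ ⊤) {M : Submodule ℂ (Lp ℂ p ν)} (hM : IsClosed (M : Set (Lp ℂ p ν)))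
    (f : Lp ℂ p ν) :
    ∃ y ∈ M, ∀ w ∈ M, ∫ x, normPowConj p.toReal ((f - y) x) * w x ∂ν = 0 := by
  obtain ⟨y, hyM, hy⟩ := exists_norm_sub_eq_infDist_of_clarkson
    (ENNReal.toReal_pos (two_pos.trans_le hp2).ne' hp)
    (Lp_norm_add_rpow_add_norm_sub_rpow_le hp2 hp) ⟨0, M.zero_mem⟩
    (M.restrictScalars ℝ).convex hM f
  have hint := integrable_normPowConj_mul (ENNReal.one_lt_two.trans_le hp2) hp (f - y)
  have re_eq_zero (w : Lp ℂ p ν) (hw : w ∈ M) :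
      (∫ x, normPowConj p.toReal ((f - y) x) * w x ∂ν).re = 0 := by
    rw [← RCLike.re_eq_complex_re, ← integral_re (hint w)]
    simp only [RCLike.re_eq_complex_re, re_normPowConj_mul]
    refine integral_norm_rpow_mul_inner_eq_zero hp2 hp _ w fun t ↦ ?_
    rw [hy, show f - y + t • w = f - (y - t • w) by abel, ← dist_eq_norm]
    exact Metric.infDist_le_dist_of_mem (M.sub_mem hyM (M.smul_of_tower_mem t hw))
  refine ⟨y, hyM, fun w hw ↦ Complex.ext (re_eq_zero w hw) ?_⟩
  have integral_I_smul : ∫ x, normPowConj p.toReal ((f - y) x) * (Complex.I • w : Lp ℂ p ν) x ∂ν =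
      Complex.I * ∫ x, normPowConj p.toReal ((f - y) x) * w x ∂ν := by
    rw [← integral_const_mul]
    refine integral_congr_ae ?_
    filter_upwards [Lp.coeFn_smul Complex.I w] with x hx
    rw [hx, Pi.smul_apply, smul_eq_mul]
    ring
  have hI := re_eq_zero (Complex.I • w) (M.smul_mem _ hw)
  rw [integral_I_smul] at hI
  simpa using hI

end NormPowConj

section Operators

variable {α : Type*} {m : MeasurableSpace α} {ν : Measure α} {p q r s : ℝ≥0∞}
  [Fact (1 ≤ p)] [Fact (1 ≤ q)]

/-- Multiplication by `w ∈ L^s` as an operator from `L^q` to `L^r`, where `1/r = 1/s + 1/q`. -/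
def mulOp [Fact (1 ≤ s)] [Fact (1 ≤ r)] [ENNReal.HolderTriple s q r]
    (w : Lp ℂ s ν) : Lp ℂ q ν →L[ℂ] Lp ℂ r ν :=
  (ContinuousLinearMap.mul ℂ ℂ).holderL ν s q r w

lemma coeFn_mulOp [Fact (1 ≤ s)] [Fact (1 ≤ r)] [ENNReal.HolderTriple s q r]
    (w : Lp ℂ s ν) (f : Lp ℂ q ν) : (mulOp w f : Lp ℂ r ν) =ᵐ[ν] fun x ↦ w x * f x :=
  (ContinuousLinearMap.mul ℂ ℂ).coeFn_holder (r := r) w f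

/-- Multiplication by an essentially bounded function as an operator on `L^p`. -/
def bmul {w : α → ℂ} (hw : MemLp w ∞ ν) : Lp ℂ p ν →L[ℂ] Lp ℂ p ν := mulOp (hw.toLp w)

lemma coeFn_bmul {w : α → ℂ} (hw : MemLp w ∞ ν) (f : Lp ℂ p ν) :
    bmul hw f =ᵐ[ν] fun x ↦ w x * f x := by
  filter_upwards [coeFn_mulOp (r := p) (hw.toLp w) f, hw.coeFn_toLp] with x hmul hcoe
  rw [bmul, hmul, hcoe]

lemma bmul_bmul_eq_self {v w : α → ℂ} (hv : MemLp v ∞ ν) (hw : MemLp w ∞ ν)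
    (hvw : ∀ᵐ x ∂ν, v x * w x = 1) (f : Lp ℂ p ν) : bmul hv (bmul hw f) = f := by
  refine Lp.ext ?_
  filter_upwards [coeFn_bmul hv (bmul hw f), coeFn_bmul hw f, hvw] with x hv hw hvw
  rw [hv, hw, ← mul_assoc, hvw, one_mul]

lemma mulOp_bmul [Fact (1 ≤ s)] [Fact (1 ≤ r)] [ENNReal.HolderTriple s q r] {v : α → ℂ}
    (hv : MemLp v ∞ ν) (w : Lp ℂ s ν) (f : Lp ℂ q ν) :
    (mulOp w (bmul hv f) : Lp ℂ r ν) = bmul hv (mulOp w f) := by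
  refine Lp.ext ?_
  filter_upwards [coeFn_mulOp (r := r) w (bmul hv f), coeFn_bmul hv f, coeFn_mulOp (r := r) w f,
    coeFn_bmul hv (mulOp w f : Lp ℂ r ν)] with x hmul hb hmul' hb'
  rw [hmul, hb, hb', hmul', mul_left_comm]

/-- The inclusion of `L^q` into `L^p` for `p ≤ q` over a finite measure space. -/
def incl [IsFiniteMeasure ν] (h : p ≤ q) : Lp ℂ q ν →L[ℂ] Lp ℂ p ν :=
  LinearMap.mkContinuous
    { toFun f := ⟨f.1, Lp.antitone h f.2⟩
      map_add' _ _ := rfl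
      map_smul' _ _ := rfl }
    (ν Set.univ ^ (1 / p.toReal - 1 / q.toReal)).toReal fun f ↦ by
    have exponent_nonneg : 0 ≤ 1 / p.toReal - 1 / q.toReal := by
      simpa using ENNReal.toReal_mono (ENNReal.inv_ne_top.2 (one_pos.trans_le
        (Fact.out : 1 ≤ p)).ne') (ENNReal.inv_le_inv.2 h)
    have const_ne_top := ENNReal.rpow_ne_top_of_nonneg exponent_nonneg (measure_ne_top ν Set.univ)
    rw [Lp.norm_def, Lp.norm_def, mul_comm, ← ENNReal.toReal_mul]
    exact ENNReal.toReal_mono (ENNReal.mul_ne_top (Lp.eLpNorm_ne_top f) const_ne_top)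
      (eLpNorm_le_eLpNorm_mul_rpow_measure_univ h (Lp.aestronglyMeasurable f))

lemma coeFn_incl [IsFiniteMeasure ν] (h : p ≤ q) (f : Lp ℂ q ν) :
    ⇑(incl h f : Lp ℂ p ν) = f := rfl

lemma incl_bmul [IsFiniteMeasure ν] (h : p ≤ q) {w : α → ℂ} (hw : MemLp w ∞ ν) (f : Lp ℂ q ν) :
    (incl h (bmul hw f) : Lp ℂ p ν) = bmul hw (incl h f) := by
  refine Lp.ext ?_
  filter_upwards [coeFn_bmul hw f, coeFn_bmul hw (incl h f : Lp ℂ p ν)] with x hq hp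
  rw [hp, coeFn_incl, coeFn_incl, hq]

end Operators

section Characters

/-- The character `z ↦ z ^ n` of the circle, as a complex function. -/
def character (n : ℤ) : C(Circle, ℂ) where
  toFun x := (x ^ n : Circle)
  continuous_toFun := coordinate.continuous.comp (continuous_zpow n)

lemma character_apply (n : ℤ) (x : Circle) : character n x = (x ^ n : Circle) := rfl

lemma character_zero (x : Circle) : character 0 x = 1 := by simp [character_apply]

lemma character_one (x : Circle) : character 1 x = x := by simp [character_apply]

lemma character_add (m n : ℤ) (x : Circle) :
    character (m + n) x = character m x * character n x := by
  simp [character_apply, zpow_add₀]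

lemma character_mul (n : ℤ) (x y : Circle) :
    character n (x * y) = character n x * character n y := by
  simp [character_apply, mul_zpow]

lemma character_neg_mul_self (n : ℤ) (x : Circle) : character (-n) x * character n x = 1 := by
  rw [← character_add, neg_add_cancel, character_zero]

lemma conj_character (n : ℤ) (x : Circle) : conj (character n x) = character (-n) x := by
  rw [character_apply, character_apply, zpow_neg, Circle.coe_inv_eq_conj]

lemma coordinate_pow_eq_character (n : ℕ) : coordinate ^ n = character n := by
  ext x
  simp only [ContinuousMap.pow_apply, character_apply, zpow_natCast, Circle.coe_pow]
  rfl

lemma memLp_top_character {ν : Measure Circle} (n : ℤ) : MemLp (character n) ∞ ν :=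
  memLp_top_of_bound (character n).continuous.aestronglyMeasurable 1
    (.of_forall fun _ ↦ (Circle.norm_coe _).le)

lemma span_character_closure_eq_top :
    (Submodule.span ℂ (Set.range character)).topologicalClosure = ⊤ := by
  let e : UnitAddCircle ≃ₜ Circle := AddCircle.homeomorphCircle one_ne_zero
  let T : C(UnitAddCircle, ℂ) →L[ℂ] C(Circle, ℂ) :=
    ContinuousMap.compCLM ℂ ℂ (e.symm : C(Circle, UnitAddCircle))
  have map_fourier (n : ℤ) : T (fourier n) = character n := by
    ext x
    have hx : (e.symm x).toCircle = x := by
      rw [← AddCircle.homeomorphCircle_apply one_ne_zero]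
      exact e.apply_symm_apply x
    change fourier n (e.symm x) = character n x
    rw [fourier_apply, AddCircle.toCircle_zsmul, hx, character_apply]
  have range_eq : Set.range character = T '' Set.range fourier := by
    rw [← Set.range_comp]
    exact congrArg Set.range (funext fun n ↦ (map_fourier n).symm)
  refine eq_top_iff.2 fun c _ ↦ ?_
  rw [range_eq, ← ContinuousLinearMap.coe_coe, Submodule.span_image]
  refine Submodule.topologicalClosure_map T _ ⟨c.comp e, ?_, ?_⟩
  · rw [span_fourier_closure_eq_top]
    trivial
  · ext x
    exact congrArg c (e.apply_symm_apply x)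

instance : haarCircle.IsHaarMeasure :=
  inferInstanceAs (Measure.haarMeasure ⊤).IsHaarMeasure

lemma integral_character_of_ne_zero {n : ℤ} (hn : n ≠ 0) : ∫ x, character n x ∂haarCircle = 0 := by
  refine integral_eq_zero_of_mul_left_eq_neg (g := Circle.exp (Real.pi / n)) fun x ↦ ?_
  have rotation : character n (Circle.exp (Real.pi / n)) = -1 := by
    have hn' : (n : ℂ) ≠ 0 := Int.cast_ne_zero.2 hn
    rw [character_apply, ← Circle.exp_intCast_mul, Circle.coe_exp]
    push_cast
    rw [mul_div_cancel₀ _ hn', Complex.exp_pi_mul_I]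
  rw [character_mul, rotation, neg_one_mul]

lemma ae_eq_zero_of_forall_integral_continuousMap_mul_eq_zero {X : Type*} [TopologicalSpace X]
    [MeasurableSpace X] [BorelSpace X] [HasOuterApproxClosed X] {ν : Measure X}
    {k : X → ℂ} (hk : Integrable k ν) (h : ∀ c : C(X, ℂ), ∫ x, c x * k x ∂ν = 0) :
    k =ᵐ[ν] 0 := by
  refine ae_eq_zero_of_forall_setIntegral_isClosed_eq_zero hk fun F hF ↦ ?_
  let c (n : ℕ) : C(X, ℂ) := ⟨fun x ↦ ((hF.apprSeq n x : ℝ) : ℂ), by fun_prop⟩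
  have hlim : Tendsto (fun n ↦ ∫ x, c n x * k x ∂ν) atTop (𝓝 (∫ x, F.indicator k x ∂ν)) := by
    refine tendsto_integral_of_dominated_convergence (fun x ↦ ‖k x‖)
      (fun n ↦ (c n).continuous.aestronglyMeasurable.mul hk.1) hk.norm
      (fun n ↦ .of_forall fun x ↦ ?_) (.of_forall fun x ↦ ?_)
    · rw [norm_mul]
      refine mul_le_of_le_one_left (norm_nonneg _) ?_
      simpa [c] using HasOuterApproxClosed.apprSeq_apply_le_one hF n x
    · have happr := tendsto_pi_nhds.1 (HasOuterApproxClosed.tendsto_apprSeq hF) x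
      have hmul := (((Complex.continuous_ofReal.comp NNReal.continuous_coe).tendsto _).comp
        happr).mul_const (k x)
      by_cases hx : x ∈ F <;> simpa [c, hx] using hmul
  rw [← integral_indicator hF.measurableSet]
  exact tendsto_nhds_unique hlim (by simp only [h, tendsto_const_nhds])

theorem ae_eq_zero_of_forall_integral_character_mul_eq_zero {ν : Measure Circle} {k : Circle → ℂ}
    (hk : Integrable k ν) (h : ∀ n : ℤ, ∫ x, character n x * k x ∂ν = 0) : k =ᵐ[ν] 0 := by
  refine ae_eq_zero_of_forall_integral_continuousMap_mul_eq_zero hk fun c ↦ ?_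
  have hint (c : C(Circle, ℂ)) : Integrable (fun x ↦ c x * k x) ν :=
    hk.bdd_mul c.continuous.aestronglyMeasurable (.of_forall c.norm_coe_le_norm)
  let L : C(Circle, ℂ) →L[ℂ] ℂ := LinearMap.mkContinuous
    { toFun c := ∫ x, c x * k x ∂ν
      map_add' c d := by
        simp only [ContinuousMap.add_apply, add_mul]
        exact integral_add (hint c) (hint d)
      map_smul' a c := by
        simp only [ContinuousMap.smul_apply, smul_eq_mul, mul_assoc, RingHom.id_apply]
        exact integral_const_mul _ _ } (∫ x, ‖k x‖ ∂ν) fun c ↦ by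
    rw [mul_comm, ← integral_const_mul]
    refine norm_integral_le_of_norm_le (hk.norm.const_mul _) (.of_forall fun x ↦ ?_)
    rw [norm_mul]
    gcongr
    exact c.norm_coe_le_norm x
  have closure_le : (Submodule.span ℂ (Set.range character)).topologicalClosure ≤ L.ker := by
    refine Submodule.topologicalClosure_minimal _ (Submodule.span_le.2 ?_) L.isClosed_ker
    rintro _ ⟨n, rfl⟩
    exact h n
  rw [span_character_closure_eq_top] at closure_le
  exact closure_le (Submodule.mem_top (x := c))

end Characters

section InvariantSubspaces

variable {ν : Measure Circle} {p q : ℝ≥0∞} [Fact (1 ≤ p)] [Fact (1 ≤ q)]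

/-- Multiplication by `z ^ n` as an operator on `L^p`. -/
def zmul (n : ℤ) : Lp ℂ p ν →L[ℂ] Lp ℂ p ν := bmul (memLp_top_character n)

lemma coeFn_zmul (n : ℤ) (f : Lp ℂ p ν) : zmul n f =ᵐ[ν] fun x ↦ character n x * f x :=
  coeFn_bmul _ f

lemma zmul_zmul (m n : ℤ) (f : Lp ℂ p ν) : zmul m (zmul n f) = zmul (m + n) f := by
  refine Lp.ext ?_
  filter_upwards [coeFn_zmul m (zmul n f), coeFn_zmul n f, coeFn_zmul (m + n) f] with x hm hn hmn
  rw [hm, hn, hmn, character_add, mul_assoc]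

lemma zmul_zero (f : Lp ℂ p ν) : zmul 0 f = f := by
  refine Lp.ext ?_
  filter_upwards [coeFn_zmul 0 f] with x hx
  rw [hx, character_zero, one_mul]

lemma mulOp_zmul {r s : ℝ≥0∞} [Fact (1 ≤ r)] [Fact (1 ≤ s)] [ENNReal.HolderTriple s q r]
    (w : Lp ℂ s ν) (n : ℤ) (f : Lp ℂ q ν) :
    (mulOp w (zmul n f) : Lp ℂ r ν) = zmul n (mulOp w f) := mulOp_bmul _ w f

lemma mulSubspace_coe_le_iff {S : Submodule ℂ (Lp ℂ p ν)} :
    mulSubspace (fun z : Circle ↦ (z : ℂ)) .rfl S ≤ S ↔ ∀ f ∈ S, zmul 1 f ∈ S := by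
  constructor
  · intro h f hf
    exact h ⟨f, hf, by simpa only [character_one] using coeFn_zmul 1 f⟩
  · rintro h f ⟨g, hg, hfg⟩
    obtain rfl : f = zmul 1 g :=
      Lp.ext (hfg.trans (by simpa only [character_one] using (coeFn_zmul 1 g).symm))
    exact h g hg

/-- A closed subspace of `L^p` that is invariant under multiplication by `z`. -/
structure IsInvariant (S : Submodule ℂ (Lp ℂ p ν)) : Prop where
  isClosed : IsClosed (S : Set (Lp ℂ p ν))
  zmul_mem : ∀ f ∈ S, zmul 1 f ∈ S

lemma isInvariant_iff_isClosed_and_mulSubspace_coe_le {S : Submodule ℂ (Lp ℂ p ν)} :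
    IsInvariant S ↔
      IsClosed (S : Set (Lp ℂ p ν)) ∧ mulSubspace (fun z : Circle ↦ (z : ℂ)) .rfl S ≤ S := by
  rw [mulSubspace_coe_le_iff]
  exact ⟨fun hS ↦ ⟨hS.isClosed, hS.zmul_mem⟩, fun hS ↦ ⟨hS.1, hS.2⟩⟩

namespace IsInvariant

variable {S : Submodule ℂ (Lp ℂ p ν)}

lemma zmul_natCast_mem (hS : IsInvariant S) (n : ℕ) {f : Lp ℂ p ν} (hf : f ∈ S) :
    zmul n f ∈ S := by
  induction n with
  | zero => rwa [Nat.cast_zero, zmul_zero]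
  | succ n ih => simpa only [zmul_zmul, Nat.cast_succ, add_comm] using hS.zmul_mem _ ih

lemma zmul_mem_of_forall_zmul_neg_one_mem (hS : IsInvariant S)
    (hneg : ∀ f ∈ S, zmul (-1) f ∈ S) (n : ℤ) {f : Lp ℂ p ν} (hf : f ∈ S) : zmul n f ∈ S := by
  induction n with
  | zero => rwa [zmul_zero]
  | succ n ih => simpa only [zmul_zmul, add_comm] using hS.zmul_mem _ ih
  | pred n ih => simpa only [zmul_zmul, sub_eq_add_neg, add_comm] using hneg _ ih

lemma comap (hS : IsInvariant S) {T : Lp ℂ q ν →L[ℂ] Lp ℂ p ν}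
    (hT : ∀ f, T (zmul 1 f) = zmul 1 (T f)) :
    IsInvariant (S.comap (T : Lp ℂ q ν →ₗ[ℂ] Lp ℂ p ν)) where
  isClosed := hS.isClosed.preimage T.continuous
  zmul_mem f hf := by
    rw [Submodule.mem_comap, ContinuousLinearMap.coe_coe, hT]
    exact hS.zmul_mem _ hf

end IsInvariant

/-- The closed `z`-invariant subspace of `L^p` generated by `f`. -/
def invariantSpan (f : Lp ℂ p ν) : Submodule ℂ (Lp ℂ p ν) :=
  (Submodule.span ℂ (Set.range fun n : ℕ ↦ zmul n f)).topologicalClosure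

lemma mem_invariantSpan_self (f : Lp ℂ p ν) : f ∈ invariantSpan f :=
  Submodule.le_topologicalClosure _
    (Submodule.subset_span ⟨0, by simp only [Nat.cast_zero, zmul_zero]⟩)

lemma isInvariant_invariantSpan (f : Lp ℂ p ν) : IsInvariant (invariantSpan f) where
  isClosed := Submodule.isClosed_topologicalClosure _
  zmul_mem g hg := by
    have shift_le : (Submodule.span ℂ (Set.range fun n : ℕ ↦ zmul n f)).map
        ((zmul 1 : Lp ℂ p ν →L[ℂ] Lp ℂ p ν) : Lp ℂ p ν →ₗ[ℂ] Lp ℂ p ν) ≤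
          Submodule.span ℂ (Set.range fun n : ℕ ↦ zmul n f) := by
      rw [Submodule.map_span_le]
      rintro _ ⟨n, rfl⟩
      refine Submodule.subset_span ⟨n + 1, ?_⟩
      simp only [ContinuousLinearMap.coe_coe, zmul_zmul, Nat.cast_succ, add_comm]
    exact Submodule.topologicalClosure_mono shift_le
      (Submodule.topologicalClosure_map _ _ (Submodule.mem_map_of_mem hg))

lemma IsInvariant.invariantSpan_le {S : Submodule ℂ (Lp ℂ p ν)} (hS : IsInvariant S)
    {f : Lp ℂ p ν} (hf : f ∈ S) : invariantSpan f ≤ S := by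
  refine Submodule.topologicalClosure_minimal _ (Submodule.span_le.2 ?_) hS.isClosed
  rintro _ ⟨n, rfl⟩
  exact hS.zmul_natCast_mem n hf

lemma map_mem_invariantSpan {T : Lp ℂ q ν →L[ℂ] Lp ℂ p ν}
    (hT : ∀ f, T (zmul 1 f) = zmul 1 (T f)) {f g : Lp ℂ q ν} (hg : g ∈ invariantSpan f) :
    T g ∈ invariantSpan (T f) :=
  ((isInvariant_invariantSpan (T f)).comap hT).invariantSpan_le (mem_invariantSpan_self (T f)) hg

lemma invariantSpan_map_congr {T : Lp ℂ q ν →L[ℂ] Lp ℂ p ν}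
    (hT : ∀ f, T (zmul 1 f) = zmul 1 (T f)) {f g : Lp ℂ q ν}
    (h : invariantSpan f = invariantSpan g) : invariantSpan (T f) = invariantSpan (T g) :=
  le_antisymm
    ((isInvariant_invariantSpan _).invariantSpan_le
      (map_mem_invariantSpan hT (h ▸ mem_invariantSpan_self f)))
    ((isInvariant_invariantSpan _).invariantSpan_le
      (map_mem_invariantSpan hT (h ▸ mem_invariantSpan_self g)))

variable [IsFiniteMeasure ν]

/-- The constant function `1` as an element of `L^p`. -/
def one (p : ℝ≥0∞) [Fact (1 ≤ p)] (ν : Measure Circle) [IsFiniteMeasure ν] : Lp ℂ p ν :=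
  ContinuousMap.toLp p ν ℂ 1

lemma coeFn_one : one p ν =ᵐ[ν] fun _ ↦ 1 :=
  ContinuousMap.coeFn_toLp ν 1

lemma toLp_character (n : ℤ) : ContinuousMap.toLp p ν ℂ (character n) = zmul n (one p ν) := by
  refine Lp.ext ?_
  filter_upwards [ContinuousMap.coeFn_toLp (p := p) (𝕜 := ℂ) ν (character n), coeFn_one (p := p),
    coeFn_zmul n (one p ν)] with x hchar hone hmul
  rw [hchar, hmul, hone, mul_one]

lemma hardySpace_eq_invariantSpan_one : hardySpace p ν = invariantSpan (one p ν) := by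
  simp only [hardySpace, invariantSpan, coordinate_pow_eq_character, toLp_character]

lemma incl_zmul (h : p ≤ q) (n : ℤ) (f : Lp ℂ q ν) :
    (incl h (zmul n f) : Lp ℂ p ν) = zmul n (incl h f) := incl_bmul h _ f

end InvariantSubspaces

section FourierCoefficients

variable {p : ℝ≥0∞} [Fact (1 ≤ p)]

/-- The `n`-th Fourier coefficient `∫ z^(-n) f` as a continuous functional on `L^p`. -/
def coeff (n : ℤ) : StrongDual ℂ (Lp ℂ p haarCircle) :=
  (L1.integralCLM' ℂ).comp ((incl Fact.out).comp (zmul (-n)))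

lemma coeff_apply (n : ℤ) (f : Lp ℂ p haarCircle) :
    coeff n f = ∫ x, character (-n) x * f x ∂haarCircle := by
  have heq : coeff n f = ∫ x, (incl Fact.out (zmul (-n) f) : Lp ℂ 1 haarCircle) x ∂haarCircle := by
    rw [← L1.integral_eq_integral, L1.integral_eq' ℂ]
    rfl
  rw [heq]
  exact integral_congr_ae (coeFn_zmul (-n) f)

lemma eq_zero_of_forall_coeff_eq_zero {f : Lp ℂ p haarCircle} (h : ∀ n, coeff n f = 0) : f = 0 := by
  refine (Lp.eq_zero_iff_ae_eq_zero).2 (ae_eq_zero_of_forall_integral_character_mul_eq_zero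
    ((Lp.memLp f).integrable Fact.out) fun n ↦ ?_)
  simpa only [coeff_apply, neg_neg] using h (-n)

lemma coeff_zmul (m n : ℤ) (f : Lp ℂ p haarCircle) : coeff m (zmul n f) = coeff (m - n) f := by
  simp only [coeff, ContinuousLinearMap.comp_apply, zmul_zmul, neg_sub', sub_neg_eq_add]

lemma coeff_one (n : ℤ) : coeff n (one p haarCircle) = if n = 0 then 1 else 0 := by
  have integral_eq : coeff n (one p haarCircle) = ∫ x, character (-n) x ∂haarCircle := by
    rw [coeff_apply]
    refine integral_congr_ae ?_
    filter_upwards [coeFn_one (p := p) (ν := haarCircle)] with x hx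
    rw [hx, mul_one]
  rw [integral_eq]
  split_ifs with hn
  · simp [hn, character_zero]
  · exact integral_character_of_ne_zero (neg_ne_zero.2 hn)

lemma coeff_incl {q : ℝ≥0∞} [Fact (1 ≤ q)] (h : p ≤ q) (n : ℤ) (f : Lp ℂ q haarCircle) :
    coeff n (incl h f : Lp ℂ p haarCircle) = coeff n f := by
  simp only [coeff_apply, coeFn_incl]

lemma coeff_domMulAct_smul (n : ℤ) (a : Circle) (f : Lp ℂ p haarCircle) :
    coeff n (DomMulAct.mk a • f) = character n a * coeff n f := by
  rw [coeff_apply, coeff_apply, ← integral_const_mul,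
    ← integral_mul_left_eq_self (fun x ↦ character n a * (character (-n) x * f x)) a]
  refine integral_congr_ae ?_
  filter_upwards [DomMulAct.smul_Lp_ae_eq (DomMulAct.mk a) f] with x hx
  rw [hx, character_mul, Equiv.symm_apply_apply, smul_eq_mul]
  linear_combination (-character (-n) x * f (a * x)) * character_neg_mul_self n a

lemma continuous_domMulAct_smul (hp : p ≠ ⊤) (f : Lp ℂ p haarCircle) :
    Continuous fun a : Circle ↦ DomMulAct.mk a • f :=
  have : Fact (p ≠ ⊤) := ⟨hp⟩
  DomMulAct.continuous_mk.smul continuous_const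

lemma integrable_character_smul_domMulAct_smul (hp : p ≠ ⊤) (n : ℤ) (f : Lp ℂ p haarCircle) :
    Integrable (fun a ↦ character n a • (DomMulAct.mk a • f)) haarCircle :=
  ((character n).continuous.smul
    (continuous_domMulAct_smul hp f)).integrable_of_hasCompactSupport (.of_compactSpace _)

lemma integral_character_smul_domMulAct_smul (hp : p ≠ ⊤) (n : ℤ) (f : Lp ℂ p haarCircle) :
    ∫ a, character n a • (DomMulAct.mk a • f) ∂haarCircle =
      coeff (-n) f • zmul (-n) (one p haarCircle) := by
  rw [← sub_eq_zero]
  refine eq_zero_of_forall_coeff_eq_zero fun m ↦ ?_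
  rw [map_sub, ← ContinuousLinearMap.integral_comp_comm _
    (integrable_character_smul_domMulAct_smul hp n f)]
  simp only [map_smul, coeff_domMulAct_smul, coeff_zmul, coeff_one, smul_eq_mul, ← mul_assoc,
    ← character_add, integral_mul_const, sub_neg_eq_add]
  rcases eq_or_ne (m + n) 0 with hmn | hmn
  · obtain rfl := eq_neg_of_add_eq_zero_left hmn
    simp [character_zero]
  · rw [integral_character_of_ne_zero (by rwa [add_comm]), if_neg hmn]
    ring

/- The rotates `a ↦ l (f(a ·))` form a continuous function on the circle whose Fourier coefficients
are the numbers `l (coeff n f • z ^ n)`. -/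
lemma apply_eq_zero_of_forall_apply_coeff_smul_eq_zero (hp : p ≠ ⊤) {f : Lp ℂ p haarCircle}
    {l : StrongDual ℂ (Lp ℂ p haarCircle)}
    (h : ∀ n, l (coeff n f • zmul n (one p haarCircle)) = 0) : l f = 0 := by
  have continuous_rotate : Continuous fun a : Circle ↦ l (DomMulAct.mk a • f) :=
    l.continuous.comp (continuous_domMulAct_smul hp f)
  have integral_rotate (n : ℤ) :
      ∫ a, character n a * l (DomMulAct.mk a • f) ∂haarCircle = 0 := by
    simpa only [← integral_character_smul_domMulAct_smul hp, neg_neg, map_smul, smul_eq_mul,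
      ← ContinuousLinearMap.integral_comp_comm _
        (integrable_character_smul_domMulAct_smul hp n f)] using h (-n)
  have rotate_eq_zero : (fun a : Circle ↦ l (DomMulAct.mk a • f)) = 0 :=
    (continuous_rotate.ae_eq_iff_eq haarCircle continuous_zero).1
      (ae_eq_zero_of_forall_integral_character_mul_eq_zero
        (continuous_rotate.integrable_of_hasCompactSupport (.of_compactSpace _)) integral_rotate)
  simpa using congrFun rotate_eq_zero 1

lemma exists_dual_eq_zero_of_notMem {E : Type*} [NormedAddCommGroup E] [NormedSpace ℂ E]
    {S : Submodule ℂ E} (hS : IsClosed (S : Set E)) {x : E} (hx : x ∉ S) :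
    ∃ l : StrongDual ℂ E, (∀ y ∈ S, l y = 0) ∧ l x ≠ 0 := by
  obtain ⟨l, hl⟩ := SeparatingDual.exists_ne_zero (R := ℂ) (x := (S.mkQ x)) (by simpa using hx)
  refine ⟨l.comp S.mkQL, fun y hy ↦ ?_, hl⟩
  rw [ContinuousLinearMap.comp_apply, Submodule.mkQL_apply, Submodule.mkQ_apply,
    (Submodule.Quotient.mk_eq_zero S).2 hy, map_zero]

theorem mem_hardySpace_iff (hp : p ≠ ⊤) {f : Lp ℂ p haarCircle} :
    f ∈ hardySpace p haarCircle ↔ ∀ n < 0, coeff n f = 0 := by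
  rw [hardySpace_eq_invariantSpan_one]
  constructor
  · intro hf n hn
    suffices invariantSpan (one p haarCircle) ≤ (coeff n).ker from this hf
    refine Submodule.topologicalClosure_minimal _ (Submodule.span_le.2 ?_)
      (coeff n).isClosed_ker
    rintro _ ⟨k, rfl⟩
    change coeff n (zmul k (one p haarCircle)) = 0
    rw [coeff_zmul, coeff_one, if_neg (by omega)]
  · intro hf
    by_contra hmem
    obtain ⟨l, hl, hlf⟩ :=
      exists_dual_eq_zero_of_notMem (isInvariant_invariantSpan (one p haarCircle)).isClosed hmem
    refine hlf ?_
    have apply_coeff_smul (n : ℤ) : l (coeff n f • zmul n (one p haarCircle)) = 0 := by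
      rcases lt_or_ge n 0 with hn | hn
      · rw [hf n hn, zero_smul, map_zero]
      · lift n to ℕ using hn
        rw [map_smul, hl _ ((isInvariant_invariantSpan _).zmul_natCast_mem n
          (mem_invariantSpan_self _)), smul_zero]
    exact apply_eq_zero_of_forall_apply_coeff_smul_eq_zero hp apply_coeff_smul

end FourierCoefficients

section BeurlingHelsonSubspaces

variable {ν : Measure Circle} {p q : ℝ≥0∞} {φ : Circle → ℂ} {E : Set Circle}

lemma mem_mulSubspace_indicator_top_iff {f : Lp ℂ p ν} :
    f ∈ mulSubspace (E.indicator fun _ ↦ (1 : ℂ)) .rfl (⊤ : Submodule ℂ (Lp ℂ p ν)) ↔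
      ∀ᵐ x ∂ν, x ∉ E → f x = 0 := by
  constructor
  · rintro ⟨h, -, hfh⟩
    filter_upwards [hfh] with x hx hxE
    rw [hx, Set.indicator_of_notMem hxE, zero_mul]
  · intro hf
    refine ⟨f, Submodule.mem_top, ?_⟩
    filter_upwards [hf] with x hx
    by_cases hxE : x ∈ E <;> simp [hxE, hx]

lemma IsUnimodular.memLp_top (hφ : IsUnimodular φ) : MemLp φ ∞ haarCircle :=
  memLp_top_of_bound hφ.1.aestronglyMeasurable 1 (hφ.2.mono fun _ h ↦ h.le)

lemma IsUnimodular.conj (hφ : IsUnimodular φ) : IsUnimodular fun x ↦ conj (φ x) :=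
  ⟨RCLike.continuous_conj.measurable.comp hφ.1, hφ.2.mono fun x h ↦ by rwa [RCLike.norm_conj]⟩

lemma IsUnimodular.conj_mul_self (hφ : IsUnimodular φ) :
    ∀ᵐ x ∂haarCircle, conj (φ x) * φ x = 1 := by
  filter_upwards [hφ.2] with x hx
  rw [Complex.conj_mul', hx, Complex.ofReal_one, one_pow]

variable [Fact (1 ≤ p)] [Fact (1 ≤ q)]

lemma bmul_conj_bmul (hφ : IsUnimodular φ) (f : Lp ℂ p haarCircle) :
    bmul hφ.conj.memLp_top (bmul hφ.memLp_top f) = f :=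
  bmul_bmul_eq_self _ _ hφ.conj_mul_self f

lemma bmul_bmul_conj (hφ : IsUnimodular φ) (f : Lp ℂ p haarCircle) :
    bmul hφ.memLp_top (bmul hφ.conj.memLp_top f) = f :=
  bmul_bmul_eq_self _ _ (by simpa only [mul_comm] using hφ.conj_mul_self) f

lemma bmul_zmul {w : Circle → ℂ} (hw : MemLp w ∞ ν) (n : ℤ) (f : Lp ℂ p ν) :
    bmul hw (zmul n f) = zmul n (bmul hw f) := mulOp_zmul _ n f

lemma mulSubspace_eq_comap_bmul_conj (hφ : IsUnimodular φ)
    (S : Submodule ℂ (Lp ℂ p haarCircle)) :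
    mulSubspace φ .rfl S = S.comap
      (bmul hφ.conj.memLp_top : Lp ℂ p haarCircle →L[ℂ] Lp ℂ p haarCircle).toLinearMap := by
  ext f
  rw [Submodule.mem_comap, ContinuousLinearMap.coe_coe]
  constructor
  · rintro ⟨h, hS, hfh⟩
    obtain rfl : f = bmul hφ.memLp_top h := Lp.ext (hfh.trans (coeFn_bmul _ h).symm)
    rwa [bmul_conj_bmul hφ]
  · intro hf
    refine ⟨_, hf, ?_⟩
    simpa only [bmul_bmul_conj hφ] using coeFn_bmul hφ.memLp_top (bmul hφ.conj.memLp_top f)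

lemma isInvariant_hardySpace [IsFiniteMeasure ν] : IsInvariant (hardySpace p ν) :=
  hardySpace_eq_invariantSpan_one (p := p) (ν := ν) ▸ isInvariant_invariantSpan _

lemma isInvariant_mulSubspace_hardySpace (hφ : IsUnimodular φ) :
    IsInvariant (mulSubspace φ .rfl (hardySpace p haarCircle)) := by
  rw [mulSubspace_eq_comap_bmul_conj hφ]
  exact isInvariant_hardySpace.comap (bmul_zmul _ 1)

lemma isInvariant_mulSubspace_indicator_top (hE : MeasurableSet E) :
    IsInvariant (mulSubspace (E.indicator fun _ ↦ (1 : ℂ)) .rfl (⊤ : Submodule ℂ (Lp ℂ p ν))) where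
  isClosed := by
    have hw : MemLp (Eᶜ.indicator fun _ ↦ (1 : ℂ)) ∞ ν :=
      (memLp_top_const 1).indicator hE.compl
    convert (bmul hw : Lp ℂ p ν →L[ℂ] Lp ℂ p ν).isClosed_ker using 1
    ext f
    rw [SetLike.mem_coe, mem_mulSubspace_indicator_top_iff, SetLike.mem_coe, LinearMap.mem_ker,
      ContinuousLinearMap.coe_coe, Lp.eq_zero_iff_ae_eq_zero]
    refine eventually_congr ?_
    filter_upwards [coeFn_bmul hw f] with x hx
    by_cases hxE : x ∈ E <;> simp [hx, hxE]
  zmul_mem f hf := by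
    rw [mem_mulSubspace_indicator_top_iff] at hf ⊢
    filter_upwards [hf, coeFn_zmul 1 f] with x hx hmul hxE
    rw [hmul, hx hxE, mul_zero]

lemma comap_incl_mulSubspace_indicator_top [IsFiniteMeasure ν] (h : p ≤ q) :
    (mulSubspace (E.indicator fun _ ↦ (1 : ℂ)) .rfl (⊤ : Submodule ℂ (Lp ℂ p ν))).comap
        (incl h : Lp ℂ q ν →L[ℂ] Lp ℂ p ν).toLinearMap =
      mulSubspace (E.indicator fun _ ↦ (1 : ℂ)) .rfl ⊤ := by
  ext f
  rw [Submodule.mem_comap, ContinuousLinearMap.coe_coe, mem_mulSubspace_indicator_top_iff,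
    mem_mulSubspace_indicator_top_iff, coeFn_incl]

lemma comap_incl_mulSubspace_hardySpace (h : p ≤ q) (hq : q ≠ ⊤) (hφ : IsUnimodular φ) :
    (mulSubspace φ .rfl (hardySpace p haarCircle)).comap
        (incl h : Lp ℂ q haarCircle →L[ℂ] Lp ℂ p haarCircle).toLinearMap =
      mulSubspace φ .rfl (hardySpace q haarCircle) := by
  ext f
  simp only [mulSubspace_eq_comap_bmul_conj hφ, Submodule.mem_comap, ContinuousLinearMap.coe_coe,
    mem_hardySpace_iff hq, mem_hardySpace_iff (ne_top_of_le_ne_top hq h), ← incl_bmul, coeff_incl]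

/-- The two kinds of subspaces in the Beurling–Helson theorem: `φ H^p` with `φ` unimodular, and
`χ_E L^p`. -/
def IsBeurlingHelson (M : Submodule ℂ (Lp ℂ p haarCircle)) : Prop :=
  (∃ φ, IsUnimodular φ ∧ M = mulSubspace φ .rfl (hardySpace p haarCircle)) ∨
    ∃ E, MeasurableSet E ∧ M = mulSubspace (E.indicator fun _ ↦ (1 : ℂ)) .rfl ⊤

lemma IsBeurlingHelson.isInvariant {M : Submodule ℂ (Lp ℂ p haarCircle)}
    (hM : IsBeurlingHelson M) : IsInvariant M := by
  rcases hM with ⟨φ, hφ, rfl⟩ | ⟨E, hE, rfl⟩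
  · exact isInvariant_mulSubspace_hardySpace hφ
  · exact isInvariant_mulSubspace_indicator_top hE

end BeurlingHelsonSubspaces

section Wiener

variable {ν : Measure Circle} {p : ℝ≥0∞} [Fact (1 ≤ p)] {M : Submodule ℂ (Lp ℂ p ν)}

lemma exists_mem_forall_ae_sub_mul_eq_zero (hp2 : 2 ≤ p) (hp : p ≠ ⊤)
    (hM : IsClosed (M : Set (Lp ℂ p ν))) (hz : ∀ n : ℤ, ∀ w ∈ M, zmul n w ∈ M) (f : Lp ℂ p ν) :
    ∃ y ∈ M, ∀ w ∈ M, ∀ᵐ x ∂ν, (f x - y x) * w x = 0 := by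
  obtain ⟨y, hyM, hy⟩ := exists_mem_forall_integral_normPowConj_mul_eq_zero hp2 hp hM f
  refine ⟨y, hyM, fun w hw ↦ ?_⟩
  have hint := integrable_normPowConj_mul (ENNReal.one_lt_two.trans_le hp2) hp (f - y) w
  have integral_eq_zero (n : ℤ) :
      ∫ x, character n x * (normPowConj p.toReal ((f - y) x) * w x) ∂ν = 0 := by
    rw [← hy _ (hz n w hw)]
    refine integral_congr_ae ?_
    filter_upwards [coeFn_zmul n w] with x hx
    rw [hx, mul_left_comm]
  filter_upwards [ae_eq_zero_of_forall_integral_character_mul_eq_zero hint integral_eq_zero,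
    Lp.coeFn_sub f y] with x hx hsub
  simpa only [hsub, Pi.zero_apply, Pi.sub_apply, mul_eq_zero, normPowConj_eq_zero_iff] using hx

theorem exists_eq_mulSubspace_indicator_top_of_forall_zmul_mem [IsFiniteMeasure ν] (hp2 : 2 ≤ p)
    (hp : p ≠ ⊤) (hM : IsClosed (M : Set (Lp ℂ p ν)))
    (hz : ∀ n : ℤ, ∀ w ∈ M, zmul n w ∈ M) :
    ∃ E, MeasurableSet E ∧ M = mulSubspace (E.indicator fun _ ↦ (1 : ℂ)) .rfl ⊤ := by
  have annihilate := exists_mem_forall_ae_sub_mul_eq_zero hp2 hp hM hz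
  obtain ⟨e, heM, he⟩ := annihilate (one p ν)
  have hE : MeasurableSet {x | e x = 1} :=
    (Lp.stronglyMeasurable e).measurable (measurableSet_singleton 1)
  have eq_zero_off {w : Lp ℂ p ν} (hw : w ∈ M) : ∀ᵐ x ∂ν, e x ≠ 1 → w x = 0 := by
    filter_upwards [he w hw, coeFn_one (p := p) (ν := ν)] with x hx hone hne
    rw [hone] at hx
    exact (mul_eq_zero.1 hx).resolve_left (sub_ne_zero.2 hne.symm)
  refine ⟨{x | e x = 1}, hE, Submodule.ext fun f ↦ ?_⟩
  rw [mem_mulSubspace_indicator_top_iff]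
  refine ⟨eq_zero_off, fun hf ↦ ?_⟩
  obtain ⟨y, hyM, hy⟩ := annihilate f
  suffices f = y from this ▸ hyM
  refine Lp.ext ?_
  filter_upwards [hf, hy e heM, eq_zero_off hyM] with x hfx hye hyx
  by_cases hx : e x = 1
  · rwa [hx, mul_one, sub_eq_zero] at hye
  · rw [hfx hx, hyx hx]

end Wiener

section Beurling

variable {p : ℝ≥0∞} [Fact (1 ≤ p)] {M : Submodule ℂ (Lp ℂ p haarCircle)}

lemma ae_eq_integral_of_forall_integral_character_mul_eq_zero {k : Circle → ℝ}
    (hk : Integrable k haarCircle)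
    (h : ∀ n : ℤ, 0 < n → ∫ x, character n x * (k x : ℂ) ∂haarCircle = 0) :
    ∀ᵐ x ∂haarCircle, k x = ∫ y, k y ∂haarCircle := by
  set c := ∫ y, k y ∂haarCircle
  have integral_neg (n : ℤ) (hn : n < 0) : ∫ x, character n x * (k x : ℂ) ∂haarCircle = 0 := by
    have hconj := congrArg conj (h (-n) (neg_pos.2 hn))
    simpa only [← integral_conj, map_mul, conj_character, neg_neg, Complex.conj_ofReal,
      map_zero] using hconj
  have integral_sub_const (n : ℤ) :
      ∫ x, character n x * ((k x - c : ℝ) : ℂ) ∂haarCircle = 0 := by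
    have hint : Integrable (fun x ↦ character n x * (k x : ℂ)) haarCircle :=
      hk.ofReal.bdd_mul (character n).continuous.aestronglyMeasurable
        (.of_forall (character n).norm_coe_le_norm)
    have hint' : Integrable (character n) haarCircle :=
      (character n).continuous.integrable_of_hasCompactSupport (.of_compactSpace _)
    simp only [Complex.ofReal_sub, mul_sub]
    rw [integral_sub hint (hint'.mul_const _), integral_mul_const]
    rcases lt_trichotomy n 0 with hn | rfl | hn
    · rw [integral_neg n hn, integral_character_of_ne_zero hn.ne, zero_mul, sub_zero]
    · simp [character_zero, c, integral_complex_ofReal]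
    · rw [h n hn, integral_character_of_ne_zero hn.ne', zero_mul, sub_zero]
  filter_upwards [ae_eq_zero_of_forall_integral_character_mul_eq_zero
    (hk.sub (integrable_const c)).ofReal integral_sub_const] with x hx
  exact sub_eq_zero.1 (Complex.ofReal_eq_zero.1 hx)

lemma IsInvariant.exists_integral_normPowConj_mul_eq_zero (hM : IsInvariant M) (hp2 : 2 ≤ p)
    (hp : p ≠ ⊤) {f : Lp ℂ p haarCircle} (hf : f ∈ M) (hzf : zmul (-1) f ∉ M) :
    ∃ F ∈ M, F ≠ 0 ∧ ∀ w ∈ M, ∀ n : ℤ, 0 < n →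
      ∫ x, character n x * (normPowConj p.toReal (F x) * w x) ∂haarCircle = 0 := by
  have hshift : IsInvariant (M.comap
      (zmul (-1) : Lp ℂ p haarCircle →L[ℂ] Lp ℂ p haarCircle).toLinearMap) :=
    hM.comap fun f ↦ by rw [zmul_zmul, zmul_zmul, add_comm]
  obtain ⟨y, hy, horth⟩ :=
    exists_mem_forall_integral_normPowConj_mul_eq_zero hp2 hp hshift.isClosed f
  have hyM : y ∈ M := by simpa [zmul_zmul, zmul_zero] using hM.zmul_mem _ hy
  refine ⟨f - y, M.sub_mem hf hyM, fun h0 ↦ hzf (sub_eq_zero.1 h0 ▸ hy), fun w hw n hn ↦ ?_⟩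
  have zmul_mem : zmul n w ∈ M.comap
      (zmul (-1) : Lp ℂ p haarCircle →L[ℂ] Lp ℂ p haarCircle).toLinearMap := by
    obtain ⟨k, hk⟩ := Int.eq_ofNat_of_zero_le (Int.le_sub_one_of_lt hn)
    rw [Submodule.mem_comap, ContinuousLinearMap.coe_coe, zmul_zmul, neg_add_eq_sub, hk]
    exact hM.zmul_natCast_mem k hw
  rw [← horth _ zmul_mem]
  refine integral_congr_ae ?_
  filter_upwards [coeFn_zmul n w] with x hx
  rw [hx, mul_left_comm]

lemma IsInvariant.exists_norm_ae_eq_const (hM : IsInvariant M) (hp2 : 2 ≤ p)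
    (hp : p ≠ ⊤) {f : Lp ℂ p haarCircle} (hf : f ∈ M) (hzf : zmul (-1) f ∉ M) :
    ∃ F ∈ M, ∃ c > 0, (∀ᵐ x ∂haarCircle, ‖F x‖ = c) ∧
      ∀ w ∈ M, ∀ n : ℤ, 0 < n → ∫ x, character n x * (conj (F x) * w x) ∂haarCircle = 0 := by
  obtain ⟨F, hFM, hF0, horth⟩ := hM.exists_integral_normPowConj_mul_eq_zero hp2 hp hf hzf
  have hr : 2 ≤ p.toReal := by simpa using ENNReal.toReal_mono hp hp2
  have norm_rpow_const := ae_eq_integral_of_forall_integral_character_mul_eq_zero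
    (Lp_integrable_norm_rpow (two_pos.trans_le hp2).ne' hp F) fun n hn ↦ by
      simpa only [normPowConj_mul_self hr] using horth F hFM n hn
  obtain ⟨c, hc⟩ : ∃ c : ℝ, ∀ᵐ x ∂haarCircle, ‖F x‖ = c := by
    refine ⟨(∫ y, ‖F y‖ ^ p.toReal ∂haarCircle) ^ p.toReal⁻¹, norm_rpow_const.mono fun x hx ↦ ?_⟩
    rw [← hx, Real.rpow_rpow_inv (norm_nonneg _) (by positivity)]
  have hc0 : c ≠ 0 := fun h0 ↦ hF0 <| Lp.eq_zero_iff_ae_eq_zero.2 <|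
    hc.mono fun x hx ↦ norm_eq_zero.1 (hx.trans h0)
  have hcpos : 0 < c := by
    obtain ⟨x, hx⟩ := hc.exists
    exact lt_of_le_of_ne (hx ▸ norm_nonneg _) hc0.symm
  refine ⟨F, hFM, c, hcpos, hc, fun w hw n hn ↦ ?_⟩
  have integral_normPowConj :
      ∫ x, character n x * (normPowConj p.toReal (F x) * w x) ∂haarCircle =
        (c ^ (p.toReal - 2) : ℝ) * ∫ x, character n x * (conj (F x) * w x) ∂haarCircle := by
    rw [← integral_const_mul]
    refine integral_congr_ae ?_
    filter_upwards [hc] with x hx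
    rw [normPowConj, hx]
    ring
  exact (mul_eq_zero.1 (integral_normPowConj.symm.trans (horth w hw n hn))).resolve_left
    (Complex.ofReal_ne_zero.2 (Real.rpow_pos_of_pos hcpos _).ne')

lemma IsInvariant.exists_isUnimodular (hM : IsInvariant M) (hp2 : 2 ≤ p)
    (hp : p ≠ ⊤) {f : Lp ℂ p haarCircle} (hf : f ∈ M) (hzf : zmul (-1) f ∉ M) :
    ∃ φ, ∃ hφ : IsUnimodular φ, bmul hφ.memLp_top (one p haarCircle) ∈ M ∧
      ∀ w ∈ M, ∀ n : ℤ, 0 < n → ∫ x, character n x * (conj (φ x) * w x) ∂haarCircle = 0 := by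
  obtain ⟨F, hFM, c, hcpos, hc, horth⟩ := hM.exists_norm_ae_eq_const hp2 hp hf hzf
  have hφ : IsUnimodular fun x ↦ (c : ℂ)⁻¹ * F x :=
    ⟨(Lp.stronglyMeasurable F).measurable.const_mul _, hc.mono fun x hx ↦ by
      rw [norm_mul, norm_inv, Complex.norm_real, Real.norm_of_nonneg hcpos.le, hx,
        inv_mul_cancel₀ hcpos.ne']⟩
  refine ⟨_, hφ, ?_, fun w hw n hn ↦ ?_⟩
  · convert M.smul_mem (c : ℂ)⁻¹ hFM using 1
    refine Lp.ext ?_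
    filter_upwards [coeFn_bmul hφ.memLp_top (one p haarCircle), Lp.coeFn_smul (c : ℂ)⁻¹ F,
      coeFn_one (p := p) (ν := haarCircle)] with x hmul hsmul hone
    rw [hmul, hsmul, hone, mul_one, Pi.smul_apply, smul_eq_mul]
  · rw [← mul_zero (conj (c : ℂ)⁻¹), ← horth w hw n hn, ← integral_const_mul]
    congr 1 with x
    rw [map_mul]
    ring

theorem IsInvariant.exists_eq_mulSubspace_hardySpace (hM : IsInvariant M) (hp2 : 2 ≤ p)
    (hp : p ≠ ⊤) {f : Lp ℂ p haarCircle} (hf : f ∈ M) (hzf : zmul (-1) f ∉ M) :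
    ∃ φ, IsUnimodular φ ∧ M = mulSubspace φ .rfl (hardySpace p haarCircle) := by
  obtain ⟨φ, hφ, hφM, horth⟩ := hM.exists_isUnimodular hp2 hp hf hzf
  refine ⟨φ, hφ, ?_⟩
  rw [mulSubspace_eq_comap_bmul_conj hφ]
  refine le_antisymm (fun w hw ↦ ?_) fun w hw ↦ ?_
  · rw [Submodule.mem_comap, ContinuousLinearMap.coe_coe, mem_hardySpace_iff hp]
    intro n hn
    rw [coeff_apply, ← horth w hw (-n) (neg_pos.2 hn)]
    refine integral_congr_ae ?_
    filter_upwards [coeFn_bmul hφ.conj.memLp_top w] with x hx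
    rw [hx]
  · rw [Submodule.mem_comap, ContinuousLinearMap.coe_coe, hardySpace_eq_invariantSpan_one] at hw
    have hmem := hM.invariantSpan_le hφM (map_mem_invariantSpan (bmul_zmul hφ.memLp_top 1) hw)
    rwa [bmul_bmul_conj hφ] at hmem

theorem IsInvariant.isBeurlingHelson_of_two_le (hM : IsInvariant M) (hp2 : 2 ≤ p) (hp : p ≠ ⊤) :
    IsBeurlingHelson M := by
  by_cases hz : ∀ f ∈ M, zmul (-1) f ∈ M
  · refine .inr (exists_eq_mulSubspace_indicator_top_of_forall_zmul_mem hp2 hp hM.isClosed ?_)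
    exact fun n w hw ↦ hM.zmul_mem_of_forall_zmul_neg_one_mem hz n hw
  · push Not at hz
    obtain ⟨f, hf, hzf⟩ := hz
    exact .inl (hM.exists_eq_mulSubspace_hardySpace hp2 hp hf hzf)

end Beurling

section OuterFunctions

variable {p : ℝ≥0∞} [Fact (1 ≤ p)]

lemma zmul_neg_one_one_notMem_hardySpace (hp : p ≠ ⊤) :
    zmul (-1) (one p haarCircle) ∉ hardySpace p haarCircle := fun hmem ↦ by
  simpa [coeff_zmul, coeff_one] using (mem_hardySpace_iff hp).1 hmem (-1) (by norm_num)

lemma zmul_neg_one_notMem_invariantSpan_toLp (hp : p ≠ ⊤) {s : Circle → ℝ} (hs1 : ∀ x, 1 ≤ s x)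
    (hs : MemLp (fun x ↦ (s x : ℂ)) p haarCircle) :
    zmul (-1) (hs.toLp _) ∉ invariantSpan (hs.toLp _) := by
  intro hmem
  have hpos (x : Circle) : 0 < s x := one_pos.trans_le (hs1 x)
  have inv_bounded : MemLp (fun x ↦ (s x : ℂ)⁻¹) ∞ haarCircle := by
    refine memLp_top_of_bound hs.1.aemeasurable.inv.aestronglyMeasurable 1 (.of_forall fun x ↦ ?_)
    rw [norm_inv, Complex.norm_real, Real.norm_of_nonneg (hpos x).le]
    exact inv_le_one_of_one_le₀ (hs1 x)
  have inv_mul : bmul inv_bounded (hs.toLp _) = one p haarCircle := by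
    refine Lp.ext ?_
    filter_upwards [coeFn_bmul inv_bounded (hs.toLp _), hs.coeFn_toLp,
      coeFn_one (p := p)] with x hmul hcoe hone
    rw [hmul, hcoe, hone, inv_mul_cancel₀ (Complex.ofReal_ne_zero.2 (hpos x).ne')]
  have hone := map_mem_invariantSpan (bmul_zmul inv_bounded 1) hmem
  rw [bmul_zmul, inv_mul, ← hardySpace_eq_invariantSpan_one] at hone
  exact zmul_neg_one_one_notMem_hardySpace hp hone

theorem exists_outer_norm_ae_eq (hp2 : 2 ≤ p) (hp : p ≠ ⊤) {s : Circle → ℝ} (hs1 : ∀ x, 1 ≤ s x)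
    (hs : MemLp (fun x ↦ (s x : ℂ)) p haarCircle) :
    ∃ h : Lp ℂ p haarCircle, (∀ᵐ x ∂haarCircle, ‖h x‖ = s x) ∧
      invariantSpan h = hardySpace p haarCircle := by
  have hpos (x : Circle) : 0 < s x := one_pos.trans_le (hs1 x)
  let σ : Lp ℂ p haarCircle := hs.toLp _
  rcases (isInvariant_invariantSpan σ).isBeurlingHelson_of_two_le hp2 hp with
    ⟨φ, hφ, hspan⟩ | ⟨E, -, hspan⟩
  · rw [mulSubspace_eq_comap_bmul_conj hφ] at hspan
    have outer_mem : bmul hφ.conj.memLp_top σ ∈ hardySpace p haarCircle := by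
      have hσ := mem_invariantSpan_self σ
      rwa [hspan, Submodule.mem_comap, ContinuousLinearMap.coe_coe] at hσ
    have symbol_mem : bmul hφ.memLp_top (one p haarCircle) ∈ invariantSpan σ := by
      rw [hspan, Submodule.mem_comap, ContinuousLinearMap.coe_coe, bmul_conj_bmul hφ,
        hardySpace_eq_invariantSpan_one]
      exact mem_invariantSpan_self _
    have one_mem : one p haarCircle ∈ invariantSpan (bmul hφ.conj.memLp_top σ) := by
      simpa only [bmul_conj_bmul hφ] using
        map_mem_invariantSpan (bmul_zmul hφ.conj.memLp_top 1) symbol_mem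
    refine ⟨bmul hφ.conj.memLp_top σ, ?_, le_antisymm ?_ ?_⟩
    · filter_upwards [coeFn_bmul hφ.conj.memLp_top σ, hs.coeFn_toLp, hφ.conj.2] with x hmul hσ hnorm
      rw [hmul, norm_mul, hnorm, one_mul, hσ, Complex.norm_real, Real.norm_of_nonneg (hpos x).le]
    · exact isInvariant_hardySpace.invariantSpan_le outer_mem
    · rw [hardySpace_eq_invariantSpan_one]
      exact (isInvariant_invariantSpan _).invariantSpan_le one_mem
  · refine absurd ?_ (zmul_neg_one_notMem_invariantSpan_toLp hp hs1 hs)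
    have hσE := mem_invariantSpan_self σ
    change zmul (-1) σ ∈ invariantSpan σ
    rw [hspan, mem_mulSubspace_indicator_top_iff] at hσE ⊢
    filter_upwards [hσE, coeFn_zmul (-1) σ] with x hx hmul hxE
    rw [hmul, hx hxE, mul_zero]

end OuterFunctions

section SquareIntegrableGenerators

variable {q r : ℝ≥0∞}

lemma memLp_rpow_div {α : Type*} [MeasurableSpace α] {ν : Measure α} {b : α → ℝ} {θ : ℝ}
    (hb : ∀ x, 0 ≤ b x) (hbq : MemLp b q ν) (hθ : 0 ≤ θ) :
    MemLp (fun x ↦ b x ^ θ) (q / ENNReal.ofReal θ) ν := by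
  simpa only [Real.norm_of_nonneg (hb _), ENNReal.toReal_ofReal hθ] using
    hbq.norm_rpow_div (ENNReal.ofReal θ)

lemma memLp_max_one_norm {α : Type*} [MeasurableSpace α] {ν : Measure α} [IsFiniteMeasure ν]
    (k : Lp ℂ q ν) : MemLp (fun x ↦ max 1 ‖k x‖) q ν :=
  (memLp_const (1 : ℝ)).sup (Lp.memLp k).norm

lemma holderTriple_div_ofReal (hq : q ≠ 0) {θ : ℝ} (hθ0 : 0 ≤ θ) (hθ1 : θ ≤ 1) :
    ENNReal.HolderTriple (q / ENNReal.ofReal (1 - θ)) (q / ENNReal.ofReal θ) q where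
  inv_add_inv_eq_inv := by
    rw [ENNReal.inv_div (.inl ENNReal.ofReal_ne_top) (.inr hq),
      ENNReal.inv_div (.inl ENNReal.ofReal_ne_top) (.inr hq), ← ENNReal.add_div,
      ← ENNReal.ofReal_add (sub_nonneg.2 hθ1) hθ0, sub_add_cancel, ENNReal.ofReal_one, one_div]

lemma two_le_of_holderTriple [Fact (1 ≤ q)] [ENNReal.HolderTriple r 2 q] : 2 ≤ r := by
  have hle : r⁻¹ + 2⁻¹ ≤ 2⁻¹ + 2⁻¹ := by
    rw [ENNReal.HolderTriple.inv_add_inv_eq_inv r 2 q, ENNReal.inv_two_add_inv_two,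
      ENNReal.inv_le_one]
    exact Fact.out
  exact ENNReal.inv_le_inv.1 (ENNReal.le_of_add_le_add_right (by simp) hle)

variable [Fact (1 ≤ q)]

/- The outer factor has modulus `max(1, |k|)^(q/2)`. -/
lemma exists_outer_factor (hq : q ≤ 2) (k : Lp ℂ q haarCircle) :
    ∃ r, ENNReal.HolderTriple r 2 q ∧ ∃ (u : Lp ℂ r haarCircle) (h : Lp ℂ 2 haarCircle),
      invariantSpan h = hardySpace 2 haarCircle ∧ ∀ᵐ x ∂haarCircle, u x * h x = k x := by
  have hqtop : q ≠ ⊤ := ne_top_of_le_ne_top ENNReal.ofNat_ne_top hq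
  have hq0 : q ≠ 0 := (one_pos.trans_le (Fact.out : 1 ≤ q)).ne'
  set θ := q.toReal / 2
  have hθ0 : 0 ≤ θ := by positivity
  have hθ1 : θ ≤ 1 := by
    have := ENNReal.toReal_mono ENNReal.ofNat_ne_top hq
    rw [ENNReal.toReal_ofNat] at this
    exact div_le_one_of_le₀ this zero_le_two
  have div_θ : q / ENNReal.ofReal θ = 2 := by
    rw [ENNReal.ofReal_div_of_pos two_pos, ENNReal.ofReal_toReal hqtop, ENNReal.ofReal_ofNat]
    exact ENNReal.div_div_cancel hq0 hqtop
  have hb1 (x : Circle) : 1 ≤ max 1 ‖k x‖ := le_max_left _ _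
  have hb0 (x : Circle) : 0 < max 1 ‖k x‖ := one_pos.trans_le (hb1 x)
  have hb := memLp_max_one_norm k
  have modulus_memLp : MemLp (fun x ↦ ((max 1 ‖k x‖ ^ θ : ℝ) : ℂ)) 2 haarCircle := by
    rw [← div_θ]
    exact (memLp_rpow_div (fun x ↦ (hb0 x).le) hb hθ0).ofReal
  obtain ⟨h, hnorm, hspan⟩ := exists_outer_norm_ae_eq le_rfl ENNReal.ofNat_ne_top
    (fun x ↦ Real.one_le_rpow (hb1 x) hθ0) modulus_memLp
  have quotient_memLp : MemLp (fun x ↦ k x / h x) (q / ENNReal.ofReal (1 - θ)) haarCircle := by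
    refine (memLp_rpow_div (fun x ↦ (hb0 x).le) hb (sub_nonneg.2 hθ1)).mono
      ((Lp.memLp k).1.aemeasurable.div (Lp.memLp h).1.aemeasurable).aestronglyMeasurable ?_
    filter_upwards [hnorm] with x hx
    rw [norm_div, hx, Real.norm_of_nonneg (Real.rpow_nonneg (hb0 x).le _), Real.rpow_sub (hb0 x),
      Real.rpow_one]
    gcongr
    exact le_max_right _ _
  refine ⟨_, div_θ ▸ holderTriple_div_ofReal hq0 hθ0 hθ1, quotient_memLp.toLp _, h, hspan, ?_⟩
  filter_upwards [quotient_memLp.coeFn_toLp, hnorm] with x hx hnx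
  have hne : h x ≠ 0 := norm_ne_zero_iff.1 (hnx ▸ (Real.rpow_pos_of_pos (hb0 x) _).ne')
  rw [hx, div_mul_cancel₀ _ hne]

theorem exists_invariantSpan_incl_eq (hq : q ≤ 2) (k : Lp ℂ q haarCircle) :
    ∃ u : Lp ℂ 2 haarCircle, invariantSpan (incl hq u : Lp ℂ q haarCircle) = invariantSpan k := by
  obtain ⟨r, _, u, h, hspan, huh⟩ := exists_outer_factor hq k
  have hr : 2 ≤ r := two_le_of_holderTriple (q := q)
  have : Fact (1 ≤ r) := ⟨one_le_two.trans hr⟩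
  have mulOp_outer : (mulOp u h : Lp ℂ q haarCircle) = k :=
    Lp.ext ((coeFn_mulOp u h).trans huh)
  have mulOp_one : (mulOp u (one 2 haarCircle) : Lp ℂ q haarCircle) = incl hq (incl hr u) := by
    refine Lp.ext ?_
    filter_upwards [coeFn_mulOp (r := q) u (one 2 haarCircle),
      coeFn_one (p := 2) (ν := haarCircle)] with x hmul hone
    rw [hmul, hone, mul_one, coeFn_incl, coeFn_incl]
  refine ⟨incl hr u, ?_⟩
  rw [← mulOp_outer, ← mulOp_one]
  exact invariantSpan_map_congr (mulOp_zmul u 1)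
    (hardySpace_eq_invariantSpan_one.symm.trans hspan.symm)

lemma IsInvariant.le_of_comap_incl_le (hq : q ≤ 2) {M N : Submodule ℂ (Lp ℂ q haarCircle)}
    (hM : IsInvariant M) (hN : IsInvariant N)
    (h : M.comap (incl hq : Lp ℂ 2 haarCircle →L[ℂ] Lp ℂ q haarCircle).toLinearMap ≤
      N.comap (incl hq : Lp ℂ 2 haarCircle →L[ℂ] Lp ℂ q haarCircle).toLinearMap) : M ≤ N := by
  intro k hk
  obtain ⟨u, hu⟩ := exists_invariantSpan_incl_eq hq k
  have huM : incl hq u ∈ M := hM.invariantSpan_le hk (hu ▸ mem_invariantSpan_self _)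
  have huN : incl hq u ∈ N := h huM
  exact hN.invariantSpan_le huN (hu ▸ mem_invariantSpan_self k)

theorem IsInvariant.isBeurlingHelson_of_le_two (hq : q ≤ 2) {M : Submodule ℂ (Lp ℂ q haarCircle)}
    (hM : IsInvariant M) : IsBeurlingHelson M := by
  have eq_of_comap_eq {N : Submodule ℂ (Lp ℂ q haarCircle)} (hN : IsInvariant N)
      (h : M.comap (incl hq : Lp ℂ 2 haarCircle →L[ℂ] Lp ℂ q haarCircle).toLinearMap =
        N.comap (incl hq : Lp ℂ 2 haarCircle →L[ℂ] Lp ℂ q haarCircle).toLinearMap) : M = N :=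
    le_antisymm (hM.le_of_comap_incl_le hq hN h.le) (hN.le_of_comap_incl_le hq hM h.ge)
  rcases (hM.comap (incl_zmul hq 1)).isBeurlingHelson_of_two_le le_rfl ENNReal.ofNat_ne_top with
    ⟨φ, hφ, hcomap⟩ | ⟨E, hE, hcomap⟩
  · refine .inl ⟨φ, hφ, eq_of_comap_eq (isInvariant_mulSubspace_hardySpace hφ) ?_⟩
    rw [hcomap, comap_incl_mulSubspace_hardySpace hq ENNReal.ofNat_ne_top hφ]
  · refine .inr ⟨E, hE, eq_of_comap_eq (isInvariant_mulSubspace_indicator_top hE) ?_⟩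
    rw [hcomap, comap_incl_mulSubspace_indicator_top hq]

theorem isInvariant_iff_isBeurlingHelson (hq : q ≠ ⊤) {M : Submodule ℂ (Lp ℂ q haarCircle)} :
    IsInvariant M ↔ IsBeurlingHelson M :=
  ⟨fun hM ↦ (le_total q 2).elim (fun h ↦ hM.isBeurlingHelson_of_le_two h)
    fun h ↦ hM.isBeurlingHelson_of_two_le h hq, fun hM ↦ hM.isInvariant⟩

end SquareIntegrableGenerators

section Weight

variable {p : ℝ≥0∞} {lam : Measure Circle}

/-- The weight `g^{-1/p}`, where `g` is the density of `lam`; multiplication by it carries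
`L^p(haarCircle)` isometrically onto `L^p(lam)`. -/
def weight (p : ℝ≥0∞) (lam : Measure Circle) (x : Circle) : ℂ :=
  ((density lam x ^ (-(1 / p.toReal)) : ℝ) : ℂ)

lemma measurable_weight : Measurable (weight p lam) :=
  Complex.measurable_ofReal.comp ((lam.measurable_rnDeriv haarCircle).ennreal_toReal.pow_const _)

variable [SigmaFinite lam]

lemma density_pos (hac : lam ≪ haarCircle) (hca : haarCircle ≪ lam) :
    ∀ᵐ x ∂haarCircle, 0 < density lam x := by
  filter_upwards [hca.ae_le (Measure.rnDeriv_pos hac), lam.rnDeriv_lt_top haarCircle]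
    with x hpos hlt
  exact ENNReal.toReal_pos hpos.ne' hlt.ne

lemma weight_ne_zero (hac : lam ≪ haarCircle) (hca : haarCircle ≪ lam) :
    ∀ᵐ x ∂haarCircle, weight p lam x ≠ 0 := by
  filter_upwards [density_pos hac hca] with x hx
  exact Complex.ofReal_ne_zero.2 (Real.rpow_pos_of_pos hx _).ne'

lemma rnDeriv_mul_enorm_weight_rpow (hp0 : p ≠ 0) (hp : p ≠ ⊤) (hac : lam ≪ haarCircle)
    (hca : haarCircle ≪ lam) :
    ∀ᵐ x ∂haarCircle, lam.rnDeriv haarCircle x * ‖weight p lam x‖ₑ ^ p.toReal = 1 := by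
  filter_upwards [density_pos hac hca, lam.rnDeriv_lt_top haarCircle] with x hpos hlt
  have hr : p.toReal ≠ 0 := (ENNReal.toReal_pos hp0 hp).ne'
  have hweight : 0 < density lam x ^ (-(1 / p.toReal)) := Real.rpow_pos_of_pos hpos _
  have hrnDeriv : ENNReal.ofReal (density lam x) = lam.rnDeriv haarCircle x :=
    ENNReal.ofReal_toReal hlt.ne
  rw [weight, ← ofReal_norm, Complex.norm_real, Real.norm_of_nonneg hweight.le,
    ENNReal.ofReal_rpow_of_pos hweight, ← Real.rpow_mul hpos.le, neg_mul, one_div_mul_cancel hr,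
    Real.rpow_neg_one, ← hrnDeriv, ← ENNReal.ofReal_mul hpos.le, mul_inv_cancel₀ hpos.ne',
    ENNReal.ofReal_one]

lemma eLpNorm_weight_mul (hp : p ≠ ⊤) (hac : lam ≪ haarCircle) (hca : haarCircle ≪ lam)
    {f : Circle → ℂ} (hf : AEStronglyMeasurable f haarCircle) :
    eLpNorm (fun x ↦ weight p lam x * f x) p lam = eLpNorm f p haarCircle := by
  rcases eq_or_ne p 0 with rfl | hp0
  · rw [eLpNorm_exponent_zero, eLpNorm_exponent_zero]
  have hmeas : AEMeasurable (fun x ↦ ‖weight p lam x * f x‖ₑ ^ p.toReal) haarCircle :=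
    (measurable_weight.aemeasurable.mul hf.aemeasurable).enorm.pow_const _
  rw [eLpNorm_eq_lintegral_rpow_enorm_toReal hp0 hp, eLpNorm_eq_lintegral_rpow_enorm_toReal hp0 hp,
    ← lintegral_rnDeriv_mul hac hmeas]
  congr 1
  refine lintegral_congr_ae ?_
  filter_upwards [rnDeriv_mul_enorm_weight_rpow hp0 hp hac hca] with x hx
  rw [enorm_mul, ENNReal.mul_rpow_of_nonneg _ _ ENNReal.toReal_nonneg, ← mul_assoc, hx, one_mul]

lemma memLp_weight_mul (hp : p ≠ ⊤) (hac : lam ≪ haarCircle) (hca : haarCircle ≪ lam)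
    (f : Lp ℂ p haarCircle) : MemLp (fun x ↦ weight p lam x * f x) p lam :=
  ⟨measurable_weight.aestronglyMeasurable.mul ((Lp.aestronglyMeasurable f).mono_ac hac),
    (eLpNorm_weight_mul hp hac hca (Lp.aestronglyMeasurable f)).trans_lt (Lp.eLpNorm_lt_top f)⟩

variable [Fact (1 ≤ p)]

/-- Multiplication by `g^{-1/p}` as an isometry of `L^p(haarCircle)` into `L^p(lam)`. -/
def weightIsometry (hp : p ≠ ⊤) (hac : lam ≪ haarCircle) (hca : haarCircle ≪ lam) :
    Lp ℂ p haarCircle →ₗᵢ[ℂ] Lp ℂ p lam where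
  toFun f := (memLp_weight_mul hp hac hca f).toLp
  map_add' f g := by
    rw [← MemLp.toLp_add]
    refine MemLp.toLp_congr _ _ ?_
    filter_upwards [hac.ae_le (Lp.coeFn_add f g)] with x hx
    simp only [hx, Pi.add_apply, mul_add]
  map_smul' c f := by
    rw [RingHom.id_apply, ← MemLp.toLp_const_smul]
    refine MemLp.toLp_congr _ _ ?_
    filter_upwards [hac.ae_le (Lp.coeFn_smul c f)] with x hx
    simp only [hx, Pi.smul_apply, smul_eq_mul, mul_left_comm]
  norm_map' f := by
    rw [LinearMap.coe_mk, AddHom.coe_mk, Lp.norm_toLp,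
      eLpNorm_weight_mul hp hac hca (Lp.aestronglyMeasurable f), Lp.norm_def]

lemma coeFn_weightIsometry (hp : p ≠ ⊤) (hac : lam ≪ haarCircle) (hca : haarCircle ≪ lam)
    (f : Lp ℂ p haarCircle) :
    weightIsometry hp hac hca f =ᵐ[lam] fun x ↦ weight p lam x * f x :=
  (memLp_weight_mul hp hac hca f).coeFn_toLp

lemma weightIsometry_surjective (hp : p ≠ ⊤) (hac : lam ≪ haarCircle) (hca : haarCircle ≪ lam) :
    Function.Surjective (weightIsometry hp hac hca) := fun h ↦ by
  have hmeas : AEStronglyMeasurable (fun x ↦ (weight p lam x)⁻¹ * h x) haarCircle :=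
    measurable_weight.inv.aestronglyMeasurable.mul ((Lp.aestronglyMeasurable h).mono_ac hca)
  have weight_mul_inv : (fun x ↦ weight p lam x * ((weight p lam x)⁻¹ * h x)) =ᵐ[lam] h := by
    filter_upwards [hac.ae_le (weight_ne_zero (p := p) hac hca)] with x hx
    rw [mul_inv_cancel_left₀ hx]
  have hmem : MemLp (fun x ↦ (weight p lam x)⁻¹ * h x) p haarCircle := by
    refine ⟨hmeas, ?_⟩
    rw [← eLpNorm_weight_mul hp hac hca hmeas, eLpNorm_congr_ae weight_mul_inv]
    exact Lp.eLpNorm_lt_top h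
  refine ⟨hmem.toLp, Lp.ext ?_⟩
  filter_upwards [coeFn_weightIsometry hp hac hca hmem.toLp, hac.ae_le hmem.coeFn_toLp,
    weight_mul_inv] with x hweight hcoe hcancel
  rw [hweight, hcoe, hcancel]

/-- Multiplication by `g^{-1/p}` as an isometric isomorphism of `L^p(haarCircle)` onto
`L^p(lam)`. -/
def weightEquiv (hp : p ≠ ⊤) (hac : lam ≪ haarCircle) (hca : haarCircle ≪ lam) :
    Lp ℂ p haarCircle ≃ₗᵢ[ℂ] Lp ℂ p lam :=
  LinearIsometryEquiv.ofSurjective (weightIsometry hp hac hca)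
    (weightIsometry_surjective hp hac hca)

lemma coeFn_weightEquiv (hp : p ≠ ⊤) (hac : lam ≪ haarCircle) (hca : haarCircle ≪ lam)
    (f : Lp ℂ p haarCircle) :
    weightEquiv hp hac hca f =ᵐ[lam] fun x ↦ weight p lam x * f x :=
  coeFn_weightIsometry hp hac hca f

lemma weightedHardy_eq_map_weightEquiv (hp : p ≠ ⊤) (hac : lam ≪ haarCircle)
    (hca : haarCircle ≪ lam) :
    weightedHardy p lam hac =
      (hardySpace p haarCircle).map (weightEquiv hp hac hca).toLinearEquiv.toLinearMap := by
  ext f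
  constructor
  · rintro ⟨h, hh, hfh⟩
    exact ⟨h, hh, Lp.ext ((coeFn_weightEquiv hp hac hca h).trans hfh.symm)⟩
  · rintro ⟨h, hh, rfl⟩
    exact ⟨h, hh, coeFn_weightEquiv hp hac hca h⟩

lemma weightEquiv_ae_eq_mul_iff (hp : p ≠ ⊤) (hac : lam ≪ haarCircle) (hca : haarCircle ≪ lam)
    (φ : Circle → ℂ) (f h : Lp ℂ p haarCircle) :
    (weightEquiv hp hac hca f =ᵐ[lam] fun x ↦ φ x * weightEquiv hp hac hca h x) ↔
      f =ᵐ[haarCircle] fun x ↦ φ x * h x := by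
  have cancel : ∀ᵐ x ∂lam, weightEquiv hp hac hca f x = φ x * weightEquiv hp hac hca h x ↔
      f x = φ x * h x := by
    filter_upwards [coeFn_weightEquiv hp hac hca f, coeFn_weightEquiv hp hac hca h,
      hac.ae_le (weight_ne_zero (p := p) hac hca)] with x hf hh hne
    rw [hf, hh, mul_left_comm, mul_right_inj' hne]
  rw [Filter.EventuallyEq, eventually_congr cancel]
  exact ⟨fun h ↦ hca.ae_le h, fun h ↦ hac.ae_le h⟩

lemma mulSubspace_map_weightEquiv (hp : p ≠ ⊤) (hac : lam ≪ haarCircle) (hca : haarCircle ≪ lam)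
    (φ : Circle → ℂ) (S : Submodule ℂ (Lp ℂ p haarCircle)) :
    mulSubspace φ .rfl (S.map (weightEquiv hp hac hca).toLinearEquiv.toLinearMap) =
      (mulSubspace φ .rfl S).map (weightEquiv hp hac hca).toLinearEquiv.toLinearMap := by
  ext f
  constructor
  · rintro ⟨-, ⟨h, hh, rfl⟩, hfh⟩
    obtain ⟨f, rfl⟩ := (weightEquiv hp hac hca).surjective f
    exact ⟨f, ⟨h, hh, (weightEquiv_ae_eq_mul_iff hp hac hca φ f h).1 hfh⟩, rfl⟩
  · rintro ⟨f, ⟨h, hh, hfh⟩, rfl⟩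
    exact ⟨_, ⟨h, hh, rfl⟩, (weightEquiv_ae_eq_mul_iff hp hac hca φ f h).2 hfh⟩

end Weight

end BeurlingCircle

end

theorem mainTheorem7_general (p : ENNReal) [Fact (1 ≤ p)] (hp : p ≠ ⊤)
    (lam : MeasureTheory.Measure Circle) [MeasureTheory.SigmaFinite lam]
    (hac : lam ≪ BeurlingCircle.haarCircle) (hca : BeurlingCircle.haarCircle ≪ lam)
    (M : Submodule ℂ (MeasureTheory.Lp ℂ p lam)) :
    (IsClosed (M : Set (MeasureTheory.Lp ℂ p lam)) ∧
      BeurlingCircle.mulSubspace (fun z : Circle => (z : ℂ))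
        MeasureTheory.Measure.AbsolutelyContinuous.rfl M ≤ M) ↔
    ((∃ φ : Circle → ℂ, BeurlingCircle.IsUnimodular φ ∧
        M = BeurlingCircle.mulSubspace φ MeasureTheory.Measure.AbsolutelyContinuous.rfl
          (BeurlingCircle.weightedHardy p lam hac)) ∨
      (∃ E : Set Circle, MeasurableSet E ∧
        M = BeurlingCircle.mulSubspace (E.indicator fun _ => (1 : ℂ))
          MeasureTheory.Measure.AbsolutelyContinuous.rfl
          (⊤ : Submodule ℂ (MeasureTheory.Lp ℂ p lam)))) := by
  let T := BeurlingCircle.weightEquiv hp hac hca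
  have map_injective : Function.Injective (Submodule.map T.toLinearEquiv.toLinearMap) :=
    Submodule.map_injective_of_injective T.injective
  obtain ⟨N, rfl⟩ : ∃ N, Submodule.map T.toLinearEquiv.toLinearMap N = M :=
    Submodule.map_surjective_of_surjective T.surjective M
  have map_top : (⊤ : Submodule ℂ (Lp ℂ p lam)) = Submodule.map T.toLinearEquiv.toLinearMap ⊤ :=
    (Submodule.map_top _ |>.trans (LinearMap.range_eq_top.2 T.surjective)).symm
  have isClosed_map_iff : IsClosed (N.map T.toLinearEquiv.toLinearMap : Set (Lp ℂ p lam)) ↔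
      IsClosed (N : Set (Lp ℂ p BeurlingCircle.haarCircle)) :=
    T.toHomeomorph.isClosed_image
  rw [map_top, BeurlingCircle.weightedHardy_eq_map_weightEquiv hp hac hca, isClosed_map_iff]
  simp only [T, BeurlingCircle.mulSubspace_map_weightEquiv hp hac hca, map_injective.eq_iff,
    Submodule.map_le_map_iff_of_injective T.injective]
  exact BeurlingCircle.isInvariant_iff_isClosed_and_mulSubspace_coe_le.symm.trans
    (BeurlingCircle.isInvariant_iff_isBeurlingHelson hp)

theorem mainTheorem7 (p : ENNReal) [Fact (1 ≤ p)] (hp : p ≠ ⊤)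
    (lam : MeasureTheory.Measure Circle) [MeasureTheory.IsProbabilityMeasure lam]
    (hac : lam ≪ BeurlingCircle.haarCircle) (hca : BeurlingCircle.haarCircle ≪ lam)
    (hlog : ∫⁻ x, ENNReal.ofReal |Real.log (BeurlingCircle.density lam x)|
      ∂BeurlingCircle.haarCircle = ⊤)
    (M : Submodule ℂ (MeasureTheory.Lp ℂ p lam)) :
    (IsClosed (M : Set (MeasureTheory.Lp ℂ p lam)) ∧
      BeurlingCircle.mulSubspace (fun z : Circle => (z : ℂ))
        MeasureTheory.Measure.AbsolutelyContinuous.rfl M ≤ M) ↔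
    ((∃ φ : Circle → ℂ, BeurlingCircle.IsUnimodular φ ∧
        M = BeurlingCircle.mulSubspace φ MeasureTheory.Measure.AbsolutelyContinuous.rfl
          (BeurlingCircle.weightedHardy p lam hac)) ∨
      (∃ E : Set Circle, MeasurableSet E ∧
        M = BeurlingCircle.mulSubspace (E.indicator fun _ => (1 : ℂ))
          MeasureTheory.Measure.AbsolutelyContinuous.rfl
          (⊤ : Submodule ℂ (MeasureTheory.Lp ℂ p lam)))) := by
  exact mainTheorem7_general p hp lam hac hca M
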